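/- Let $\mathbb S^n=(\mathbb R^{n+1}\smallsetminus\{0\})/\mathbb R_{>0}$ be the projective sphere with the quotient topology, and for $U\subset\mathbb R^{n+1}$ let $\mathbb S(U)$ be the image of $U\smallsetminus\{0\}$. A subset of $\mathbb S^n$ is \emph{convex} if it is $\mathbb S(U)$ for a convex cone $U$, and \emph{properly convex} if moreover its closure contains no pair of antipodal points; a \emph{properly convex domain} is a nonempty open properly convex subset. Let $\mathrm{SL}^{\pm}_{n+1}\mathbb R$ be the group of matrices of determinant $\pm1$. A subgroup $\Gamma$ of it \emph{divides} a properly convex domain $\Omega$ if $\Gamma$ is discrete, preserves $\Omega$ and acts cocompactly on it, i.e. $\Omega=\Gamma K$ for some compact $K\subset\Omega$. A \emph{mirror polytope} in $\mathbb S^n$ with facets labelled by a finite set $S$ consists of linear forms $\alpha_s$ and vectors $b_s$ ($s\in S$) with $\alpha_s(b_s)=2$ such that $P=\bigcap_{s}\mathbb S(\{\alpha_s\le 0\})$ is properly convex with nonempty interior, no half-space $\mathbb S(\{\alpha_s\le0\})$ contains the intersection of the others, and for all $s\ne t$ the numbers $\alpha_s(b_t),\alpha_t(b_s)$ are both negative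 or both zero. Its reflections are $\sigma_s=\mathrm{Id}-\alpha_s\otimes b_s\in\mathrm{SL}^\pm_{n+1}\mathbb R$, its facets are $P\cap\mathbb S(\ker\alpha_s)$, and its Cartan matrix $(\alpha_s(b_t))_{s,t}$ is considered up to conjugation by positive diagonal matrices. A projective rotation of angle $\varphi\in(0,2\pi)$ is a linear map that is the identity on a subspace $H$ of codimension $2$ and induces on $\mathbb R^{n+1}/H$ a map conjugate to the rotation matrix of angle $\varphi$. The dihedral angle at a ridge (face of codimension $2$) $s\cap t$ is $\theta\in(0,\pi/2]$ if $\sigma_s\sigma_t$ is a projective rotation of angle $2\theta$, and $0$ if there is no such $\theta$. The mirror polytope is a \emph{Coxeter polytope} if each dihedral angle is $0$ or $\pi/m$ for an integer $m\ge2$. Let $t_3=\frac12\bigl(11+9\sqrt2-3\sqrt{31+22\sqrt2}\bigr)$ and, for $t\in[t_3,1]$ and $q=0,1,2,3$, let $$f(t)=\frac{t(t+2)^3(2t+1)^3}{(t^2+t+1)^2(t^2+7t+1)^2},\qquad h(t)=2+\frac1t+\frac{t(t+2)^4}{(t^2+t+1)(t^2+7t+1)},$$ $$g_q(t)=\frac{2t^q(t+2)^q(2t+1)^{3-q}}{(t^2+t+1)(t^2+7t+1)},\qquad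 \overline g_q(t)=\frac{4f(t)}{g_q(t)}.$$ Let $C_t=\begin{pmatrix}A_t&-h(t)I_5\\-2I_5&B_t\end{pmatrix}$, with rows and columns indexed by $1',\dots,5',1,\dots,5$, where $A_t$ and $B_t$ are the $5\times5$ matrices with diagonal entries $2$ and with $(A_t)_{ij}=-\overline g_{j-i-1}(t)$, $(B_t)_{ij}=-1/t$ for $i<j$, and $(A_t)_{ij}=-g_{i-j-1}(t)$, $(B_t)_{ij}=-t$ for $i>j$. For $\alpha\in[0,\pi/3]$, let $P_\alpha$ denote a mirror polytope in $\mathbb S^4$ with ten facets and Cartan matrix $C_t$, where $t\in[t_3,1]$ satisfies $f(t)=\cos^2\alpha$. Then for every integer $p\ge3$ a mirror polytope $P_{\pi/p}$ exists, and every such $P_{\pi/p}$ is a Coxeter polytope. Moreover, if $\Gamma_p\subset\mathrm{SL}^{\pm}_5\mathbb R$ is the subgroup generated by its reflections, then the orbit $\Omega_p=\bigcup_{\gamma\in\Gamma_p}\gamma P_{\pi/p}$ is a properly convex domain of $\mathbb S^4$ (in particular it is open, so it equals its interior), and $\Gamma_p$ divides $\Omega_p$. -/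

import Mathlib

open scoped Pointwise

noncomputable section

namespace ProjGeom

/-- The vector space `ℝⁿ⁺¹`. -/
abbrev Vec (n : ℕ) : Type := Fin (n + 1) → ℝ

/-- The projective sphere `𝕊ⁿ = (ℝⁿ⁺¹ ∖ {0}) / ℝ_{>0}`; the antipode of `x` is `-x`. -/
abbrev ProjSphere (n : ℕ) : Type := Module.Ray ℝ (Vec n)

/-- The canonical projection `ℝⁿ⁺¹ ∖ {0} → 𝕊ⁿ`. -/
def toSphere (n : ℕ) (v : {v : Vec n // v ≠ 0}) : ProjSphere n := rayOfNeZero ℝ v.1 v.2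

/-- The quotient topology on `𝕊ⁿ`. -/
instance instTopologicalSpaceProjSphere (n : ℕ) : TopologicalSpace (ProjSphere n) :=
  TopologicalSpace.coinduced (toSphere n) inferInstance

/-- `𝕊(U)`, the image of `U ∖ {0}` in the projective sphere. -/
def sph {n : ℕ} (U : Set (Vec n)) : Set (ProjSphere n) :=
  {x | ∃ (v : Vec n) (hv : v ≠ 0), v ∈ U ∧ rayOfNeZero ℝ v hv = x}

/-- A subset of `𝕊ⁿ` is convex if it is `𝕊(U)` for a convex cone `U`. -/
def IsConvex {n : ℕ} (P : Set (ProjSphere n)) : Prop :=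
  ∃ U : ConvexCone ℝ (Vec n), P = sph (U : Set (Vec n))

/-- Properly convex: convex, and the closure contains no pair of antipodal points. -/
def IsProperlyConvex {n : ℕ} (P : Set (ProjSphere n)) : Prop :=
  IsConvex P ∧ ∀ x ∈ closure P, -x ∉ closure P

/-- A properly convex domain: a nonempty open properly convex subset. -/
def IsProperlyConvexDomain {n : ℕ} (Ω : Set (ProjSphere n)) : Prop :=
  Ω.Nonempty ∧ IsOpen Ω ∧ IsProperlyConvex Ω

/-- The closed half-space `𝕊({α ≤ 0})`. -/
def halfSpace {n : ℕ} (α : Module.Dual ℝ (Vec n)) : Set (ProjSphere n) := sph {v | α v ≤ 0}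

/-- The set `P` is a projective polytope with `(α s)` as its minimal family of defining forms. -/
def IsProjectivePolytope {n : ℕ} {S : Type} (P : Set (ProjSphere n))
    (α : S → Module.Dual ℝ (Vec n)) : Prop :=
  IsProperlyConvex P ∧ (interior P).Nonempty ∧ P = ⋂ s, halfSpace (α s) ∧
    ∀ s, ¬ ((⋂ t ∈ {t : S | t ≠ s}, halfSpace (α t)) ⊆ halfSpace (α s))

/-- The group `SL^±_{n+1} ℝ` of linear automorphisms of `ℝⁿ⁺¹` of determinant `±1`. -/
def SLpm (n : ℕ) : Subgroup (Vec n ≃ₗ[ℝ] Vec n) where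
  carrier := {g | LinearEquiv.det g = 1 ∨ LinearEquiv.det g = -1}
  one_mem' := by simp
  mul_mem' := by
    rintro a b (ha | ha) (hb | hb) <;> simp [ha, hb]
  inv_mem' := by
    rintro a (ha | ha) <;> simp [ha]

/-- The topology of `SL^±_{n+1} ℝ` as a space of matrices. -/
instance instTopologicalSpaceSLpm (n : ℕ) : TopologicalSpace (SLpm n) :=
  TopologicalSpace.induced
    (fun g => LinearMap.toMatrix' ((g : Vec n ≃ₗ[ℝ] Vec n) : Vec n →ₗ[ℝ] Vec n)) inferInstance

/-- The group `Γ` divides `Ω`: `Ω` is a properly convex domain preserved by `Γ`, and `Γ` is a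
discrete subgroup of `SL^±_{n+1} ℝ` acting cocompactly on `Ω`. -/
def Divides {n : ℕ} (Γ : Subgroup (SLpm n)) (Ω : Set (ProjSphere n)) : Prop :=
  IsProperlyConvexDomain Ω ∧ (∀ γ ∈ Γ, γ • Ω = Ω) ∧ DiscreteTopology Γ ∧
    ∃ K : Set (ProjSphere n), IsCompact K ∧ K ⊆ Ω ∧ Ω = ⋃ γ ∈ Γ, γ • K

theorem reflection_mem_SLpm {n : ℕ} {α : Module.Dual ℝ (Vec n)} {b : Vec n} (h : α b = 2) :
    Module.reflection h ∈ SLpm n := by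
  have h1 : Module.reflection h * Module.reflection h = 1 := by
    ext1 v
    exact Module.involutive_reflection h v
  have h2 : LinearEquiv.det (Module.reflection h) * LinearEquiv.det (Module.reflection h) = 1 := by
    rw [← map_mul, h1, map_one]
  have h3 : ((LinearEquiv.det (Module.reflection h) : ℝˣ) : ℝ) *
      ((LinearEquiv.det (Module.reflection h) : ℝˣ) : ℝ) = 1 := by
    rw [← Units.val_mul, h2, Units.val_one]
  rcases mul_self_eq_one_iff.1 h3 with h4 | h4
  · exact Or.inl (Units.ext (by simpa using h4))
  · exact Or.inr (Units.ext (by simpa using h4))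

/-- The projective reflection `Id - α ⊗ b`, where `α(b) = 2`. -/
def projReflection {n : ℕ} (α : Module.Dual ℝ (Vec n)) (b : Vec n) (h : α b = 2) : SLpm n :=
  ⟨Module.reflection h, reflection_mem_SLpm h⟩

/-- `g` is a projective rotation of angle `θ`: it is the identity on a subspace `H` of
codimension 2, and on `ℝⁿ⁺¹ / H` it is given, in some basis, by the rotation matrix of angle `θ`,
where `0 < θ < 2π`. -/
def IsRotation {n : ℕ} (g : SLpm n) (θ : ℝ) : Prop :=
  0 < θ ∧ θ < 2 * Real.pi ∧
    ∃ (H : Submodule ℝ (Vec n))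
      (hH : H ≤ H.comap ((g : Vec n ≃ₗ[ℝ] Vec n) : Vec n →ₗ[ℝ] Vec n))
      (e : Module.Basis (Fin 2) ℝ (Vec n ⧸ H)),
      (∀ v ∈ H, (g : Vec n ≃ₗ[ℝ] Vec n) v = v) ∧
      LinearMap.toMatrix e e
          (H.mapQ H ((g : Vec n ≃ₗ[ℝ] Vec n) : Vec n →ₗ[ℝ] Vec n) hH) =
        !![Real.cos θ, -Real.sin θ; Real.sin θ, Real.cos θ]

/-- A mirror polytope in `𝕊ⁿ` with facets labelled by the finite set `S`, given by pairs
`(α s, b s)`: the polytope is `{α s ≤ 0 for all s}`, and the reflections are `Id - α s ⊗ b s`. -/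
structure MirrorPolytope (n : ℕ) (S : Type) [Finite S] where
  α : S → Module.Dual ℝ (Vec n)
  b : S → Vec n
  carrier : Set (ProjSphere n)
  isPolytope : IsProjectivePolytope carrier α
  apply_self : ∀ s, α s (b s) = 2
  sign : ∀ s t, s ≠ t → (α s (b t) < 0 ∧ α t (b s) < 0) ∨ (α s (b t) = 0 ∧ α t (b s) = 0)

namespace MirrorPolytope

variable {n : ℕ} {S : Type} [Finite S]

/-- The reflection along the facet `s`. -/
def refl (P : MirrorPolytope n S) (s : S) : SLpm n :=
  projReflection (P.α s) (P.b s) (P.apply_self s)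

/-- The facet with label `s`. -/
def facet (P : MirrorPolytope n S) (s : S) : Set (ProjSphere n) :=
  P.carrier ∩ sph {v | P.α s v = 0}

/-- The intersection of the facets `s` and `t` is a ridge, that is, a face of dimension `n - 2`:
the cone over it spans a linear subspace of dimension `n - 1`. -/
def IsRidge (P : MirrorPolytope n S) (s t : S) : Prop :=
  s ≠ t ∧ Module.finrank ℝ (Submodule.span ℝ
    {v : Vec n | ∃ hv : v ≠ 0, rayOfNeZero ℝ v hv ∈ P.facet s ∩ P.facet t}) + 2 = n + 1

/-- `θ` is the dihedral angle at `s ∩ t`: either `θ ∈ (0, π/2]` and the product of the two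
reflections is a rotation of angle `2θ`, or that product is no such rotation and `θ = 0`. -/
def IsDihedralAngle (P : MirrorPolytope n S) (s t : S) (θ : ℝ) : Prop :=
  (0 < θ ∧ θ ≤ Real.pi / 2 ∧ IsRotation (P.refl s * P.refl t) (2 * θ)) ∨
  (θ = 0 ∧ ¬ ∃ φ : ℝ, 0 < φ ∧ φ ≤ Real.pi / 2 ∧ IsRotation (P.refl s * P.refl t) (2 * φ))

/-- A Coxeter polytope: each dihedral angle is `π / m` for an integer `m ≥ 2` or `m = ∞`. -/
def IsCoxeter (P : MirrorPolytope n S) : Prop :=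
  ∀ s t, P.IsRidge s t → ∀ θ, P.IsDihedralAngle s t θ →
    θ = 0 ∨ ∃ m : ℕ, 2 ≤ m ∧ θ = Real.pi / m

/-- The subgroup of `SL^±_{n+1} ℝ` generated by the reflections of `P`. -/
def reflectionGroup (P : MirrorPolytope n S) : Subgroup (SLpm n) :=
  Subgroup.closure (Set.range P.refl)

/-- The union of the images of `P` under its reflection group. -/
def orbit (P : MirrorPolytope n S) : Set (ProjSphere n) :=
  ⋃ γ ∈ P.reflectionGroup, γ • P.carrier

/-- `A` is the Cartan matrix `(α s (b t))` of `P`. The pairs `(α s, b s)` are determined by the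
mirror polytope only up to `(d s • α s, (d s)⁻¹ • b s)` with `d s > 0`, so that the Cartan matrix
is defined up to conjugation by a positive diagonal matrix. -/
def HasCartanMatrix (P : MirrorPolytope n S) (A : Matrix S S ℝ) : Prop :=
  ∃ d : S → ℝ, (∀ s, 0 < d s) ∧ ∀ s t, P.α s (P.b t) = d s * A s t * (d t)⁻¹

end MirrorPolytope

def t₃ : ℝ := (1 / 2) * (11 + 9 * √2 - 3 * √(31 + 22 * √2))

def f (t : ℝ) : ℝ :=
  t * (t + 2) ^ 3 * (2 * t + 1) ^ 3 / ((t ^ 2 + t + 1) ^ 2 * (t ^ 2 + 7 * t + 1) ^ 2)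

def h (t : ℝ) : ℝ :=
  2 + 1 / t + t * (t + 2) ^ 4 / ((t ^ 2 + t + 1) * (t ^ 2 + 7 * t + 1))

/-- The function `g_p`, used for `p = 0, 1, 2, 3`. -/
def g (p : ℕ) (t : ℝ) : ℝ :=
  2 * t ^ p * (t + 2) ^ p * (2 * t + 1) ^ (3 - p) / ((t ^ 2 + t + 1) * (t ^ 2 + 7 * t + 1))

def gbar (p : ℕ) (t : ℝ) : ℝ := 4 * f t / g p t

/-- The `10 × 10` matrix `C_t`; the index `Sum.inl i` stands for the facet `F'_i` and the index
`Sum.inr i` for the facet `F_i`. -/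
def C (t : ℝ) : Matrix (Fin 5 ⊕ Fin 5) (Fin 5 ⊕ Fin 5) ℝ :=
  Matrix.fromBlocks
    !![2, -gbar 0 t, -gbar 1 t, -gbar 2 t, -gbar 3 t;
       -g 0 t, 2, -gbar 0 t, -gbar 1 t, -gbar 2 t;
       -g 1 t, -g 0 t, 2, -gbar 0 t, -gbar 1 t;
       -g 2 t, -g 1 t, -g 0 t, 2, -gbar 0 t;
       -g 3 t, -g 2 t, -g 1 t, -g 0 t, 2]
    (Matrix.diagonal fun _ => -h t)
    (Matrix.diagonal fun _ => -2)
    !![2, -(1 / t), -(1 / t), -(1 / t), -(1 / t);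
       -t, 2, -(1 / t), -(1 / t), -(1 / t);
       -t, -t, 2, -(1 / t), -(1 / t);
       -t, -t, -t, 2, -(1 / t);
       -t, -t, -t, -t, 2]

/-- `P` is the mirror polytope `P_a`, where `a ∈ [0, π/3]`: its Cartan matrix is `C_t` for the
parameter `t ∈ [t₃, 1]` that satisfies `cos² a = f t`. -/
def IsPolytopeOfAngle (a : ℝ) (P : MirrorPolytope 4 (Fin 5 ⊕ Fin 5)) : Prop :=
  a ∈ Set.Icc 0 (Real.pi / 3) ∧
    ∃ t ∈ Set.Icc t₃ 1, Real.cos a ^ 2 = f t ∧ P.HasCartanMatrix (C t)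

end ProjGeom

end

/-! Write `A`, `B` for the diagonal blocks of `C t`. Everything rests on `A * B = 2h • 1`
(`blockA_mul_blockB`): the upper five rows of `C t` are `-A/2` times the lower five, so the matrix
has rank 5 and is realized in `ℝ⁵` by explicit forms and poles (`stdForm_stdPole`). The parameter
exists by the intermediate value theorem, as `f` runs from `1/4` at `t₃` to `1` at `1`
(`exists_f_eq`).

Products of opposite entries are `4 f t = 4 cos² (π/p)` in the block `A`, `1 = 4 cos² (π/3)` in `B`,
and `0` or `2h > 4` between the blocks. This is Vinberg's condition on all pairs. Comparing traces
turns it into the Coxeter condition (`IsVinberg.isCoxeter`). By the length argument of Tits and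
Vinberg (`α_smul_nonpos`) the translates of the cone over `P` form a convex cone, and the group is
discrete.

`divides_orbit` needs two further inputs. Openness: stabilizers of nonzero points of the cone are
finite, because at most two facets of each family meet at such a point (`eq_zero_of_three_zeros`)
and facets with equal index in the two families are disjoint. A stabilizer is thus generated by two
commuting finite groups, each trivial, of order two or dihedral. Proper convexity: each group
element moves a point of the cone by a nonnegative combination of the poles, points of the cone are
such combinations themselves, and all poles lie in an open half-space. The half-space comes from a
positive left eigenvector of `B` with negative eigenvalue (`exists_pos_vecMul_blockB_neg`).
Cocompactness is clear, since `P` is compact. -/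

noncomputable section

/-! ### Alternating products of two involutions -/

/-- The alternating product `x * y * x * ⋯` with `k` factors. -/
def altProd {G : Type*} [Group G] (x y : G) : ℕ → G
  | 0 => 1
  | k + 1 => x * altProd y x k

section altProd

variable {G : Type*} [Group G]

theorem altProd_two_mul (x y : G) (j : ℕ) : altProd x y (2 * j) = (x * y) ^ j := by
  induction j with
  | zero => simp [altProd]
  | succ j ih =>
    rw [show 2 * (j + 1) = 2 * j + 1 + 1 by ring, altProd, altProd, ih, pow_succ', mul_assoc]

theorem altProd_comm {x y : G} (hx : x * x = 1) (hy : y * y = 1) {m : ℕ}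
    (h : (x * y) ^ m = 1) : altProd x y m = altProd y x m := by
  have hyx : y * x = (x * y)⁻¹ := by
    rw [mul_inv_rev, inv_eq_of_mul_eq_one_right hx, inv_eq_of_mul_eq_one_right hy]
  obtain ⟨j, rfl | rfl⟩ := Nat.even_or_odd' m
  · rw [altProd_two_mul, altProd_two_mul, hyx, inv_pow, eq_inv_iff_mul_eq_one, ← pow_add,
      ← two_mul, h]
  · have hy' : y⁻¹ = y := inv_eq_of_mul_eq_one_right hy
    have hc : x * (y * x) ^ (2 * j) = (x * y) ^ (2 * j) * x :=
      SemiconjBy.pow_right (show SemiconjBy x (y * x) (x * y) by simp [SemiconjBy, mul_assoc]) _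
    rw [altProd, altProd, altProd_two_mul, altProd_two_mul, ← mul_inv_eq_one, mul_inv_rev, hy',
      ← inv_pow, ← hyx, mul_assoc, ← mul_assoc _ _ y, ← pow_add, ← two_mul, ← mul_assoc, hc,
      mul_assoc, ← pow_succ, h]

/-- A product of letters `x`, `y` is an alternating product with at most as many factors, and with
at most `m` factors if a braid relation of length `m ≠ 0` holds. -/
theorem exists_altProd_eq_list_prod {x y : G} (hx : x * x = 1) (hy : y * y = 1) {m : ℕ}
    (hm : m ≠ 0 → altProd x y m = altProd y x m) (l : List G) (hl : ∀ z ∈ l, z = x ∨ z = y) :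
    ∃ k ≤ l.length, (m ≠ 0 → k ≤ m) ∧ (l.prod = altProd x y k ∨ l.prod = altProd y x k) := by
  -- Prepending a letter either cancels the first letter or lengthens the word. At full length `m`
  -- the braid relation first rewrites the word so that cancellation occurs. The value `m = 0` means
  -- that no relation is imposed.
  have key : ∀ x y : G, x * x = 1 → (m ≠ 0 → altProd x y m = altProd y x m) → ∀ (n k : ℕ) (w : G),
      k ≤ n → (m ≠ 0 → k ≤ m) → (w = altProd x y k ∨ w = altProd y x k) →
      ∃ k ≤ n + 1, (m ≠ 0 → k ≤ m) ∧ (x * w = altProd x y k ∨ x * w = altProd y x k) := by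
    intro x y hx hm n k w hk hkm hw
    have hshort : ∀ j, w = altProd x y (j + 1) → x * w = altProd y x j := by
      rintro j rfl
      rw [altProd, ← mul_assoc, hx, one_mul]
    rcases hw with hw | hw
    · cases k with
      | zero =>
        exact ⟨1, by omega, by omega, Or.inl (by rw [hw]; rfl)⟩
      | succ j => exact ⟨j, by omega, fun h => by have := hkm h; omega, Or.inr (hshort j hw)⟩
    · by_cases h : m ≠ 0 ∧ k = m
      · obtain ⟨h0, rfl⟩ := h
        obtain ⟨j, rfl⟩ := Nat.exists_eq_succ_of_ne_zero h0
        exact ⟨j, by omega, by omega, Or.inr (hshort j (by rw [hw, hm h0]))⟩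
      · exact ⟨k + 1, by omega, fun h' => by have := hkm h'; omega, Or.inl (by rw [hw]; rfl)⟩
  induction l with
  | nil => exact ⟨0, by simp, by simp, Or.inl (by simp [altProd])⟩
  | cons z l ih =>
    obtain ⟨k, hk, hkm, hw⟩ := ih fun z' hz' => hl z' (List.mem_cons_of_mem _ hz')
    rw [List.prod_cons, List.length_cons]
    rcases hl z List.mem_cons_self with rfl | rfl
    · exact key _ _ hx hm _ k _ hk hkm hw
    · obtain ⟨k, h1, h2, h3⟩ := key z x hy (fun h => (hm h).symm) _ k _ hk hkm hw.symm
      exact ⟨k, h1, h2, h3.symm⟩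

/-- Every element of a group generated by involutions is a product of generators. -/
theorem exists_list_of_mem_closure_involutions {X : Set G} (hX : ∀ x ∈ X, x * x = 1) {w : G}
    (hw : w ∈ Subgroup.closure X) : ∃ l : List G, (∀ z ∈ l, z ∈ X) ∧ l.prod = w := by
  rw [← Subgroup.mem_toSubmonoid, Subgroup.closure_toSubmonoid] at hw
  obtain ⟨l, hl, rfl⟩ := Submonoid.exists_list_of_mem_closure hw
  refine ⟨l, fun z hz => ?_, rfl⟩
  rcases hl z hz with h | h
  · exact h
  · rw [← inv_inv z, inv_eq_of_mul_eq_one_right (hX _ h)]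
    exact h

/-- Two involutions whose product has finite order generate a finite group. -/
theorem finite_closure_pair {x y : G} (hx : x * x = 1) (hy : y * y = 1) {m : ℕ} (hm : m ≠ 0)
    (h : (x * y) ^ m = 1) : (Subgroup.closure {x, y} : Set G).Finite := by
  have hfin : (altProd x y '' Set.Iic m ∪ altProd y x '' Set.Iic m).Finite :=
    ((Set.finite_Iic m).image _).union ((Set.finite_Iic m).image _)
  refine hfin.subset fun w hw => ?_
  obtain ⟨l, hl, rfl⟩ := exists_list_of_mem_closure_involutions
    (by rintro z (rfl | rfl) <;> assumption) hw
  obtain ⟨k, -, hk, hw⟩ := exists_altProd_eq_list_prod hx hy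
    (fun _ => altProd_comm hx hy h) l hl
  exact hw.imp (fun h => ⟨k, hk hm, h.symm⟩) fun h => ⟨k, hk hm, h.symm⟩

end altProd

/-! ### Chebyshev sequences -/

/-- The sequence `u₀ = 0`, `u₁ = 1`, `uₖ₊₂ = 2 c uₖ₊₁ - uₖ`. -/
def chebSeq (c : ℝ) : ℕ → ℝ
  | 0 => 0
  | 1 => 1
  | k + 2 => 2 * c * chebSeq c (k + 1) - chebSeq c k

/-- At `c = cos θ` the sequence is `sin (kθ) / sin θ`. Its sign controls which alternating words
keep a chamber on one side of a wall. -/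
theorem chebSeq_cos_mul_sin (θ : ℝ) (k : ℕ) :
    chebSeq (Real.cos θ) k * Real.sin θ = Real.sin (k * θ) := by
  induction k using Nat.twoStepInduction with
  | zero => simp [chebSeq]
  | one => simp [chebSeq]
  | more k h1 h2 =>
    rw [chebSeq, sub_mul, h1, mul_assoc, h2]
    push_cast
    have e1 : ((k : ℝ) + 2) * θ = (k + 1) * θ + θ := by ring
    have e2 : (k : ℝ) * θ = (k + 1) * θ - θ := by ring
    rw [e1, e2, Real.sin_add, Real.sin_sub]
    ring

theorem chebSeq_nonneg_of_le {m : ℕ} (hm : 2 ≤ m) {k : ℕ} (hk : k ≤ m) :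
    0 ≤ chebSeq (Real.cos (Real.pi / m)) k := by
  have hm' : (2 : ℝ) ≤ m := by exact_mod_cast hm
  have hs : 0 < Real.sin (Real.pi / m) := by
    apply Real.sin_pos_of_pos_of_lt_pi (by positivity)
    rw [div_lt_iff₀ (by linarith)]
    nlinarith [Real.pi_pos]
  have h := chebSeq_cos_mul_sin (Real.pi / m) k
  refine nonneg_of_mul_nonneg_left (h ▸ ?_) hs
  apply Real.sin_nonneg_of_nonneg_of_le_pi (by positivity)
  rw [mul_div_assoc', div_le_iff₀ (by linarith), mul_comm]
  have : (k : ℝ) ≤ m := by exact_mod_cast hk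
  gcongr

theorem chebSeq_nonneg_of_one_le {c : ℝ} (hc : 1 ≤ c) (k : ℕ) : 0 ≤ chebSeq c k := by
  -- Monotonicity has to be carried along for the induction to close.
  suffices h : 0 ≤ chebSeq c k ∧ chebSeq c k ≤ chebSeq c (k + 1) from h.1
  induction k with
  | zero => simp [chebSeq]
  | succ k ih =>
    refine ⟨ih.1.trans ih.2, ?_⟩
    rw [chebSeq]
    nlinarith [ih.1, ih.2, mul_nonneg (sub_nonneg.2 hc) (ih.1.trans ih.2)]

/-! ### Pairs of reflections and Vinberg's condition -/

namespace ProjGeom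

namespace MirrorPolytope

variable {n : ℕ} {S : Type} [Finite S] (P : MirrorPolytope n S)

theorem refl_smul (s : S) (v : Vec n) : P.refl s • v = v - P.α s v • P.b s :=
  Module.reflection_apply v (P.apply_self s)

theorem refl_mul_self (s : S) : P.refl s * P.refl s = 1 := by
  apply Subtype.ext
  ext1 v
  exact Module.involutive_reflection (P.apply_self s) v

theorem refl_smul_refl_smul (s : S) (v : Vec n) : P.refl s • P.refl s • v = v := by
  rw [smul_smul, refl_mul_self, one_smul]

theorem α_refl_smul (s t : S) (v : Vec n) :
    P.α s (P.refl t • v) = P.α s v - P.α t v * P.α s (P.b t) := by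
  rw [refl_smul, map_sub, map_smul, smul_eq_mul]

theorem α_refl_smul_self (s : S) (v : Vec n) : P.α s (P.refl s • v) = - P.α s v := by
  rw [α_refl_smul, apply_self]; ring

/-- Vinberg's condition on a pair of facets, where `m = 0` stands for `m = ∞`. -/
def PairOrder (s t : S) (m : ℕ) : Prop :=
  (2 ≤ m ∧ P.α s (P.b t) * P.α t (P.b s) = 4 * Real.cos (Real.pi / m) ^ 2) ∨
    (m = 0 ∧ 4 ≤ P.α s (P.b t) * P.α t (P.b s))

variable {P}

theorem cos_pi_div_nonneg {m : ℕ} (hm : 2 ≤ m) : 0 ≤ Real.cos (Real.pi / m) := by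
  have hm' : (2 : ℝ) ≤ m := by exact_mod_cast hm
  apply Real.cos_nonneg_of_mem_Icc
  constructor
  · have : 0 ≤ Real.pi / m := by positivity
    linarith [Real.pi_pos]
  · gcongr

/-- The product has the trace parameter of a rotation of angle `2π/m`, and powers of products of
reflections are given by Chebyshev polynomials in that parameter. -/
theorem PairOrder.refl_mul_refl_pow {s t : S} {m : ℕ} (h : P.PairOrder s t m) (hst : s ≠ t) :
    (P.refl s * P.refl t) ^ m = 1 := by
  rcases h with ⟨hm, h⟩ | ⟨rfl, -⟩
  swap
  · simp
  apply Subtype.ext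
  ext1 z
  change (((Module.reflection (P.apply_self s) * Module.reflection (P.apply_self t)) ^ m :
    Vec n ≃ₗ[ℝ] Vec n)) z = z
  -- For `m = 2` the sine of `2θ = π` vanishes and cannot be cancelled, but there the reflections
  -- simply commute.
  rcases hm.eq_or_lt with rfl | hm
  · have h0 : P.α s (P.b t) * P.α t (P.b s) = 0 := by rw [h]; simp
    have h1 : P.α s (P.b t) = 0 ∧ P.α t (P.b s) = 0 := by
      rcases P.sign s t hst with h' | h'
      · nlinarith [mul_pos_of_neg_of_neg h'.1 h'.2]
      · exact h'
    simp only [pow_two, LinearEquiv.mul_apply, Module.reflection_apply, map_sub, map_smul, h1,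
      P.apply_self]
    module
  have hm' : (3 : ℝ) ≤ m := by exact_mod_cast hm
  set θ := Real.pi / m with hθ
  have hmθ : m * θ = Real.pi := by rw [hθ]; field_simp
  have hs : Real.sin (2 * θ) ≠ 0 := by
    apply ne_of_gt
    have : 0 < θ := by positivity
    apply Real.sin_pos_of_pos_of_lt_pi (by positivity)
    nlinarith
  have hS : ∀ k : ℤ, (Polynomial.Chebyshev.S ℝ k).eval (2 * Real.cos (2 * θ)) * Real.sin (2 * θ) =
      Real.sin ((k + 1) * (2 * θ)) := fun k => Polynomial.Chebyshev.S_two_mul_real_cos _ k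
  have ht : 2 * Real.cos (2 * θ) = P.α s (P.b t) * P.α t (P.b s) - 2 := by
    rw [h, Real.cos_two_mul]; ring
  rw [Module.reflection_mul_reflection_pow_apply _ _ m z _ ht]
  -- For even `m` the relevant polynomial is a multiple of `sin π`. For odd `m` a sum of two
  -- neighbouring ones vanishes because `sin (π + θ) + sin (π - θ) = 0`.
  obtain ⟨k, rfl | rfl⟩ := Nat.even_or_odd' m
  · have e1 : (((2 * k : ℕ) : ℤ) - 2) / 2 = k - 1 := by push_cast; omega
    have e2 : (((2 * k : ℕ) : ℤ) - 1) / 2 = k - 1 := by push_cast; omega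
    have hz : (Polynomial.Chebyshev.S ℝ ((k : ℤ) - 1)).eval (2 * Real.cos (2 * θ)) = 0 := by
      apply (mul_eq_zero.1 _).resolve_right hs
      rw [hS, ← Real.sin_pi, ← hmθ]
      push_cast; ring_nf
    rw [e1, e2, hz]; simp
  · have e1 : (((2 * k + 1 : ℕ) : ℤ) - 2) / 2 = k - 1 := by push_cast; omega
    have e2 : (((2 * k + 1 : ℕ) : ℤ) - 1) / 2 = k := by push_cast; omega
    have e3 : (((2 * k + 1 : ℕ) : ℤ) - 3) / 2 = k - 1 := by push_cast; omega
    have e4 : (((2 * k + 1 : ℕ) : ℤ)) / 2 = k := by push_cast; omega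
    have hz : (Polynomial.Chebyshev.S ℝ (k : ℤ)).eval (2 * Real.cos (2 * θ)) +
        (Polynomial.Chebyshev.S ℝ ((k : ℤ) - 1)).eval (2 * Real.cos (2 * θ)) = 0 := by
      apply (mul_eq_zero.1 _).resolve_right hs
      rw [add_mul, hS, hS]
      have f1 : (((k : ℤ) : ℝ) + 1) * (2 * θ) = Real.pi + θ := by
        rw [← hmθ]; push_cast; ring
      have f2 : ((((k : ℤ) - 1 : ℤ) : ℝ) + 1) * (2 * θ) = Real.pi - θ := by
        rw [← hmθ]; push_cast; ring
      rw [f1, f2, Real.sin_pi_sub, add_comm, Real.sin_add]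
      simp
    rw [e1, e2, e3, e4, hz]; simp

/-- The values of the form `α s` along an alternating product of reflections. -/
theorem α_altProd_smul {s t : S} {c ρ : ℝ} (hρ : ρ ≠ 0) (h1 : P.α s (P.b t) = -(2 * ρ * c))
    (h2 : P.α t (P.b s) = -(2 * ρ⁻¹ * c)) (v : Vec n) (j : ℕ) :
    (P.α s (altProd (P.refl t) (P.refl s) (2 * j) • v) =
        chebSeq c (2 * j + 1) * P.α s v + chebSeq c (2 * j) * (ρ * P.α t v) ∧
      ρ * P.α t (altProd (P.refl s) (P.refl t) (2 * j) • v) =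
        chebSeq c (2 * j + 1) * (ρ * P.α t v) + chebSeq c (2 * j) * P.α s v) ∧
    (P.α s (altProd (P.refl t) (P.refl s) (2 * j + 1) • v) =
        chebSeq c (2 * j + 1) * P.α s v + chebSeq c (2 * j + 2) * (ρ * P.α t v) ∧
      ρ * P.α t (altProd (P.refl s) (P.refl t) (2 * j + 1) • v) =
        chebSeq c (2 * j + 1) * (ρ * P.α t v) + chebSeq c (2 * j + 2) * P.α s v) := by
  -- Expanding the first reflection and using that the second one negates its own form gives the
  -- recurrence of `chebSeq`. The factor `ρ` makes it symmetric in `s` and `t`.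
  have hstep : ∀ k, P.α s (altProd (P.refl t) (P.refl s) (k + 2) • v) =
        2 * c * (ρ * P.α t (altProd (P.refl s) (P.refl t) (k + 1) • v)) -
          P.α s (altProd (P.refl t) (P.refl s) k • v) ∧
      ρ * P.α t (altProd (P.refl s) (P.refl t) (k + 2) • v) =
        2 * c * P.α s (altProd (P.refl t) (P.refl s) (k + 1) • v) -
          ρ * P.α t (altProd (P.refl s) (P.refl t) k • v) := by
    intro k
    constructor
    · rw [altProd, mul_smul, α_refl_smul, h1, altProd, mul_smul, α_refl_smul_self]
      ring
    · rw [altProd, mul_smul, α_refl_smul, h2, altProd, mul_smul, α_refl_smul_self]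
      field_simp
      ring
  have hu : ∀ k, chebSeq c (k + 2) = 2 * c * chebSeq c (k + 1) - chebSeq c k := fun k => by
    rw [chebSeq]
  induction j with
  | zero =>
    simp only [altProd, chebSeq, mul_smul, one_smul, α_refl_smul, h1, h2]
    refine ⟨⟨by ring, by ring⟩, by ring, ?_⟩
    field_simp
    ring
  | succ j ih =>
    obtain ⟨⟨a1, a2⟩, a3, a4⟩ := ih
    have e : 2 * (j + 1) = 2 * j + 2 := by ring
    rw [e]
    have b1 := (hstep (2 * j)).1
    have b2 := (hstep (2 * j)).2
    rw [a1, a4] at b1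
    rw [a2, a3] at b2
    have b3 := (hstep (2 * j + 1)).1
    have b4 := (hstep (2 * j + 1)).2
    have c1 := hu (2 * j)
    have c2 := hu (2 * j + 1)
    have c3 := hu (2 * j + 2)
    simp only [add_assoc, Nat.reduceAdd] at b1 b2 b3 b4 c1 c2 c3 a1 a2 a3 a4 ⊢
    rw [b2, a3] at b3
    rw [b1, a4] at b4
    refine ⟨⟨?_, ?_⟩, ?_, ?_⟩
    · rw [b1, c2, c1]; ring
    · rw [b2, c2, c1]; ring
    · rw [b3, c3, c2, c1]; ring
    · rw [b4, c3, c2, c1]; ring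

/-- Rescaling one form makes both off-diagonal entries `-2c`, with `c = cos (π/m)` for finite `m`
and `c ≥ 1` for `m = ∞`. -/
theorem PairOrder.exists_scale {s t : S} {m : ℕ} (h : P.PairOrder s t m) (hst : s ≠ t) :
    ∃ c ρ : ℝ, 0 < ρ ∧ P.α s (P.b t) = -(2 * ρ * c) ∧ P.α t (P.b s) = -(2 * ρ⁻¹ * c) ∧
      ∀ k, (m ≠ 0 → k ≤ m) → 0 ≤ chebSeq c k := by
  have key : ∀ c : ℝ, 0 ≤ c → P.α s (P.b t) * P.α t (P.b s) = 4 * c ^ 2 →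
      ∃ ρ : ℝ, 0 < ρ ∧ P.α s (P.b t) = -(2 * ρ * c) ∧ P.α t (P.b s) = -(2 * ρ⁻¹ * c) := by
    intro c hc h
    rcases P.sign s t hst with ⟨h1, h2⟩ | ⟨h1, h2⟩
    · have hc' : 0 < c := by
        rcases hc.eq_or_lt with rfl | hc
        · nlinarith [mul_pos_of_neg_of_neg h1 h2]
        · exact hc
      refine ⟨-P.α s (P.b t) / (2 * c), by apply div_pos <;> linarith, by field_simp, ?_⟩
      have h1' := h1.ne
      field_simp
      linarith
    · have : c = 0 := by
        rw [h1] at h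
        nlinarith
      exact ⟨1, one_pos, by simp [h1, this], by simp [h2, this]⟩
  rcases h with ⟨hm, h⟩ | ⟨rfl, h⟩
  · obtain ⟨ρ, h1, h2, h3⟩ := key _ (cos_pi_div_nonneg hm) h
    exact ⟨_, ρ, h1, h2, h3, fun k hk => chebSeq_nonneg_of_le hm (hk (by omega))⟩
  · set A := P.α s (P.b t) * P.α t (P.b s) with hA
    have hs : √A ^ 2 = A := Real.sq_sqrt (by linarith)
    obtain ⟨ρ, h1, h2, h3⟩ := key (√A / 2) (by positivity) (by rw [div_pow, hs]; ring)
    refine ⟨_, ρ, h1, h2, h3, fun k _ => chebSeq_nonneg_of_one_le ?_ k⟩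
    have : 2 ≤ √A := Real.le_sqrt_of_sq_le (by linarith)
    linarith

/-- The value is a combination of `α s v` and `ρ * α t v` with Chebyshev coefficients of index at
most `k + 1 ≤ m`, which are nonnegative. This is the dihedral case of `α_smul_nonpos`. -/
theorem PairOrder.α_altProd_smul_nonpos {s t : S} {m : ℕ} (h : P.PairOrder s t m) (hst : s ≠ t)
    {v : Vec n} (hs : P.α s v ≤ 0) (ht : P.α t v ≤ 0) {k : ℕ} (hk : m ≠ 0 → k < m) :
    P.α s (altProd (P.refl t) (P.refl s) k • v) ≤ 0 := by
  obtain ⟨c, ρ, hρ, h1, h2, hc⟩ := h.exists_scale hst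
  have ht' : ρ * P.α t v ≤ 0 := mul_nonpos_of_nonneg_of_nonpos hρ.le ht
  obtain ⟨j, rfl | rfl⟩ := Nat.even_or_odd' k
  · rw [(α_altProd_smul hρ.ne' h1 h2 v j).1.1]
    have u1 := hc (2 * j) fun h => (hk h).le
    have u2 := hc (2 * j + 1) fun h => hk h
    nlinarith
  · rw [(α_altProd_smul hρ.ne' h1 h2 v j).2.1]
    have u1 := hc (2 * j + 1) fun h => (hk h).le
    have u2 := hc (2 * j + 2) fun h => hk h
    nlinarith

end MirrorPolytope

/-! ### Word length and convexity of the Tits cone -/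

namespace MirrorPolytope

variable {n : ℕ} {S : Type} [Finite S] (P : MirrorPolytope n S)

/-- The cone over the polytope `P`. -/
def cone : Set (Vec n) := {v | ∀ s, P.α s v ≤ 0}

/-- The union of the images of the cone over `P` under the reflection group. -/
def titsCone : Set (Vec n) := {v | ∃ w ∈ P.reflectionGroup, ∃ x ∈ P.cone, w • x = v}

/-- The word length with respect to the reflections of `P`. -/
def len (w : SLpm n) : ℕ := sInf {k | ∃ l : List S, l.length = k ∧ (l.map P.refl).prod = w}

/-- Vinberg's condition, satisfied by all pairs of facets. -/
def IsVinberg : Prop := ∀ s t, s ≠ t → ∃ m, P.PairOrder s t m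

variable {P}

theorem refl_mem (s : S) : P.refl s ∈ P.reflectionGroup := Subgroup.subset_closure ⟨s, rfl⟩

theorem list_prod_mem (l : List S) : (l.map P.refl).prod ∈ P.reflectionGroup :=
  Subgroup.list_prod_mem _ fun x hx => by
    obtain ⟨s, -, rfl⟩ := List.mem_map.1 hx
    exact refl_mem s

theorem exists_list_of_mem {w : SLpm n} (hw : w ∈ P.reflectionGroup) :
    ∃ l : List S, (l.map P.refl).prod = w := by
  obtain ⟨l, hl, rfl⟩ := exists_list_of_mem_closure_involutions
    (by rintro _ ⟨s, rfl⟩; exact P.refl_mul_self s) hw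
  obtain ⟨l', rfl⟩ : l ∈ Set.range (List.map P.refl) := by
    rw [Set.range_list_map]
    exact hl
  exact ⟨l', rfl⟩

theorem exists_list_length_eq_len {w : SLpm n} (hw : w ∈ P.reflectionGroup) :
    ∃ l : List S, l.length = P.len w ∧ (l.map P.refl).prod = w :=
  Nat.sInf_mem (s := {k | ∃ l : List S, l.length = k ∧ (l.map P.refl).prod = w})
    (let ⟨l, hl⟩ := exists_list_of_mem hw; ⟨_, l, rfl, hl⟩)

theorem len_list_prod_le (l : List S) : P.len (l.map P.refl).prod ≤ l.length :=
  Nat.sInf_le ⟨l, rfl, rfl⟩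

theorem len_list_prod_mul_le (l : List S) {w : SLpm n} (hw : w ∈ P.reflectionGroup) :
    P.len ((l.map P.refl).prod * w) ≤ l.length + P.len w := by
  obtain ⟨l', h1, rfl⟩ := exists_list_length_eq_len hw
  rw [← h1, ← List.prod_append, ← List.map_append, ← List.length_append]
  exact len_list_prod_le _

theorem len_refl_mul_le (s : S) {w : SLpm n} (hw : w ∈ P.reflectionGroup) :
    P.len (P.refl s * w) ≤ P.len w + 1 := by
  simpa [add_comm] using len_list_prod_mul_le [s] hw

theorem exists_list_eq_altProd (s t : S) (k : ℕ) :
    ∃ l : List S, l.length = k ∧ (l.map P.refl).prod = altProd (P.refl s) (P.refl t) k := by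
  induction k generalizing s t with
  | zero => exact ⟨[], rfl, rfl⟩
  | succ k ih =>
    obtain ⟨l, h1, h2⟩ := ih t s
    exact ⟨s :: l, by simp [h1], by simp [h2, altProd]⟩

theorem len_altProd_mul_le (s t : S) (k : ℕ) {w : SLpm n} (hw : w ∈ P.reflectionGroup) :
    P.len (altProd (P.refl s) (P.refl t) k * w) ≤ k + P.len w := by
  obtain ⟨l, h1, h2⟩ := exists_list_eq_altProd (P := P) s t k
  rw [← h2, ← h1]
  exact len_list_prod_mul_le l hw

theorem refl_mul_refl_mul (s : S) (w : SLpm n) : P.refl s * (P.refl s * w) = w := by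
  rw [← mul_assoc, refl_mul_self, one_mul]

theorem exists_len_refl_mul {w : SLpm n} (hw : w ∈ P.reflectionGroup) (h1 : w ≠ 1) :
    ∃ s, P.len (P.refl s * w) + 1 = P.len w := by
  obtain ⟨l, hl, rfl⟩ := exists_list_length_eq_len hw
  cases l with
  | nil => simp at h1
  | cons s l =>
    refine ⟨s, ?_⟩
    rw [List.map_cons, List.prod_cons, refl_mul_refl_mul]
    have h2 := len_refl_mul_le (P := P) s (list_prod_mem l)
    have h3 := len_list_prod_le (P := P) l
    rw [List.length_cons, List.map_cons, List.prod_cons] at hl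
    rw [List.map_cons, List.prod_cons] at *
    omega

/-- If `w` is not longer than `σ_s w`, then `w` maps the cone over `P` into the half-space
`α_s ≤ 0`. -/
theorem α_smul_nonpos (hP : P.IsVinberg) {w : SLpm n} (hw : w ∈ P.reflectionGroup) {s : S}
    (hs : P.len w ≤ P.len (P.refl s * w)) {x : Vec n} (hx : x ∈ P.cone) :
    P.α s (w • x) ≤ 0 := by
  induction hN : P.len w using Nat.strong_induction_on generalizing w s with
  | _ N ih =>
  subst hN
  by_cases hw1 : w = 1
  · rw [hw1, one_smul]
    exact hx s
  obtain ⟨t, ht⟩ := exists_len_refl_mul hw hw1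
  have hst : s ≠ t := by
    rintro rfl
    omega
  obtain ⟨m, hm⟩ := hP s t hst
  -- Factor `w = u v` with `u` in the dihedral group of `s, t`, lengths adding up and `v` as short
  -- as possible: a minimal coset representative.
  let Q : ℕ → Prop := fun d => ∃ (l : List S) (v : SLpm n), v ∈ P.reflectionGroup ∧
    (∀ r ∈ l, r = s ∨ r = t) ∧ (l.map P.refl).prod * v = w ∧ l.length + P.len v = P.len w ∧
    P.len v = d
  have hQ : ∃ d, Q d := ⟨_, [t], P.refl t * w, mul_mem (refl_mem t) hw, by simp,
    by simp [refl_mul_refl_mul], by simp; omega, rfl⟩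
  classical
  obtain ⟨l, v, hv, hl, hlv, hlen, hd⟩ := Nat.find_spec hQ
  have hmin : ∀ {d}, Q d → P.len v ≤ d := fun h => hd ▸ Nat.find_min' hQ h
  have hvlt : P.len v < P.len w := by
    have := hmin ⟨[t], P.refl t * w, mul_mem (refl_mem t) hw, by simp,
      by simp [refl_mul_refl_mul], by simp; omega, rfl⟩
    omega
  -- If a reflection in `s` or `t` shortened `v`, it could be moved into the dihedral factor,
  -- against minimality. So the induction hypothesis applies to `v` and both walls.
  have hdown : ∀ r, r = s ∨ r = t → P.α r (v • x) ≤ 0 := by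
    intro r hr
    refine ih _ hvlt hv ?_ rfl
    by_contra! hlt
    have hv' := mul_mem (refl_mem r) hv
    have h1 := len_refl_mul_le r hv'
    rw [refl_mul_refl_mul] at h1
    have := hmin ⟨l ++ [r], P.refl r * v, hv', ?_, ?_, ?_, rfl⟩
    · omega
    · simpa [or_imp, forall_and, hr] using hl
    · simp [mul_assoc, refl_mul_refl_mul, hlv]
    · simp; omega
  have hcomm := altProd_comm (P.refl_mul_self s) (P.refl_mul_self t) (hm.refl_mul_refl_pow hst)
  obtain ⟨k, hk, hkm, hprod⟩ := exists_altProd_eq_list_prod (P.refl_mul_self s)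
    (P.refl_mul_self t) (fun _ => hcomm) (l.map P.refl) (by
      intro z hz
      obtain ⟨r, hr, rfl⟩ := List.mem_map.1 hz
      exact (hl r hr).imp (congrArg _) (congrArg _))
  rw [List.length_map] at hk
  -- A dihedral factor starting with `s` would make `σ_s w` shorter than `w`.
  have hno : ∀ j, k = j → (l.map P.refl).prod = altProd (P.refl s) (P.refl t) j → False := by
    rintro j rfl hj
    cases k with
    | zero =>
      rw [hj, altProd, one_mul] at hlv
      rw [hlv] at hvlt
      omega
    | succ j =>
      rw [← hlv, hj, altProd, mul_assoc, refl_mul_refl_mul, ← mul_assoc] at hs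
      have := len_altProd_mul_le t s j hv
      change P.len (altProd (P.refl s) (P.refl t) (j + 1) * v) ≤ _ at hs
      rw [← hj, hlv] at hs
      omega
  rcases hprod with hprod | hprod
  · exact (hno k rfl hprod).elim
  · rw [← hlv, hprod, mul_smul]
    refine hm.α_altProd_smul_nonpos hst (hdown s (Or.inl rfl)) (hdown t (Or.inr rfl)) fun h0 => ?_
    -- At length exactly `m` the braid relation would let the factor start with `s`.
    refine lt_of_le_of_ne (hkm h0) ?_
    rintro rfl
    exact hno k rfl (hprod.trans hcomm.symm)

theorem len_refl_mul_lt_of_α_pos (hP : P.IsVinberg) {w : SLpm n} (hw : w ∈ P.reflectionGroup)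
    {s : S} {x : Vec n} (hx : x ∈ P.cone) (h : 0 < P.α s (w • x)) :
    P.len (P.refl s * w) < P.len w := by
  by_contra! h'
  exact h.not_ge (α_smul_nonpos hP hw h' hx)

/-- Every nontrivial element maps the cone over `P` out of its interior. -/
theorem exists_α_smul_nonneg (hP : P.IsVinberg) {w : SLpm n} (hw : w ∈ P.reflectionGroup)
    (h1 : w ≠ 1) {x : Vec n} (hx : x ∈ P.cone) : ∃ s, 0 ≤ P.α s (w • x) := by
  obtain ⟨s, hs⟩ := exists_len_refl_mul hw h1
  refine ⟨s, ?_⟩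
  have := α_smul_nonpos hP (mul_mem (refl_mem s) hw) (s := s)
    (by rw [refl_mul_refl_mul]; omega) hx
  rw [mul_smul, α_refl_smul_self] at this
  linarith

theorem smul_mem_titsCone {w : SLpm n} (hw : w ∈ P.reflectionGroup) {v : Vec n}
    (hv : v ∈ P.titsCone) : w • v ∈ P.titsCone := by
  obtain ⟨u, hu, x, hx, rfl⟩ := hv
  exact ⟨w * u, mul_mem hw hu, x, hx, mul_smul _ _ _⟩

theorem cone_subset_titsCone : P.cone ⊆ P.titsCone :=
  fun x hx => ⟨1, one_mem _, x, hx, one_smul _ _⟩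

theorem smul_comm_real (w : SLpm n) (c : ℝ) (v : Vec n) : w • c • v = c • w • v :=
  map_smul (w : Vec n ≃ₗ[ℝ] Vec n) c v

/-- Follow the segment from `x` to `w • y` until it leaves the cone through a wall `s`, and reflect
the rest in that wall. There `σ_s w` is shorter than `w`, so induction on the length applies. -/
theorem combination_mem_titsCone (hP : P.IsVinberg) {w : SLpm n} (hw : w ∈ P.reflectionGroup)
    {x y : Vec n} (hx : x ∈ P.cone) (hy : y ∈ P.cone) {a b : ℝ} (ha : 0 ≤ a) (hb : 0 ≤ b) :
    a • x + b • w • y ∈ P.titsCone := by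
  induction hN : P.len w using Nat.strong_induction_on generalizing w x a b with
  | _ N ih =>
  subst hN
  by_cases hpos : ∃ s, 0 < P.α s (w • y)
  swap
  · push Not at hpos
    refine cone_subset_titsCone fun s => ?_
    rw [map_add, map_smul, map_smul, smul_eq_mul, smul_eq_mul]
    have h1 := hx s
    have h2 := hpos s
    nlinarith
  obtain ⟨s, hs, hmin⟩ : ∃ s, 0 < P.α s (w • y) ∧ ∀ r, 0 < P.α r (w • y) →
      -P.α s x / P.α s (w • y) ≤ -P.α r x / P.α r (w • y) :=
    Set.exists_min_image {s | 0 < P.α s (w • y)} (fun s => -P.α s x / P.α s (w • y))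
      (Set.toFinite _) hpos
  -- The exit time: `x + c • w • y` stays in the cone exactly for `0 ≤ c ≤ τ` among `c ≥ 0`.
  set τ := -P.α s x / P.α s (w • y) with hτ
  have hτ0 : 0 ≤ τ := div_nonneg (by linarith [hx s]) hs.le
  have hz : ∀ c, 0 ≤ c → c ≤ τ → ∀ r, P.α r x + c * P.α r (w • y) ≤ 0 := by
    intro c hc0 hc r
    by_cases hr : 0 < P.α r (w • y)
    · have h1 := hc.trans (hmin r hr)
      rw [le_div_iff₀ hr] at h1
      linarith
    · have := hx r
      nlinarith
  by_cases hba : b ≤ a * τ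
  · refine cone_subset_titsCone fun r => ?_
    rw [map_add, map_smul, map_smul, smul_eq_mul, smul_eq_mul]
    rcases ha.eq_or_lt with rfl | ha'
    · have : b = 0 := by linarith
      simp [this]
    · have h1 := hz (b / a) (by positivity) (by rw [div_le_iff₀ ha']; linarith) r
      have : a * P.α r x + b * P.α r (w • y) = a * (P.α r x + b / a * P.α r (w • y)) := by
        field_simp
      rw [this]
      exact mul_nonpos_of_nonneg_of_nonpos ha h1
  · have hz' : x + τ • w • y ∈ P.cone := fun r => by
      simpa using hz τ hτ0 le_rfl r
    have hzs : P.α s (x + τ • w • y) = 0 := by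
      rw [map_add, map_smul, smul_eq_mul, hτ]
      field_simp
      ring
    -- The exit point `x + τ • w • y` lies on the wall of `s`, so `σ_s` fixes it. Applying `σ_s` to
    -- the combination with weights `a` and `b - a * τ` returns the original one.
    have h1 := ih _ (len_refl_mul_lt_of_α_pos hP hw hy hs) (mul_mem (refl_mem s) hw) hz' ha
      (b := b - a * τ) (by linarith) rfl
    have h2 := smul_mem_titsCone (refl_mem s) h1
    convert h2 using 1
    rw [smul_add, smul_comm_real, smul_comm_real, mul_smul, refl_smul_refl_smul, refl_smul, hzs]
    generalize w • y = z
    module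

/-- The cone `⋃ w, w • P.cone` is convex. -/
def titsConvexCone (hP : P.IsVinberg) : ConvexCone ℝ (Vec n) where
  carrier := P.titsCone
  smul_mem' := by
    rintro c hc _ ⟨w, hw, x, hx, rfl⟩
    refine ⟨w, hw, c • x, fun s => ?_, smul_comm_real _ _ _⟩
    rw [map_smul, smul_eq_mul]
    exact mul_nonpos_of_nonneg_of_nonpos hc.le (hx s)
  add_mem' := by
    rintro _ ⟨w, hw, x, hx, rfl⟩ _ ⟨u, hu, y, hy, rfl⟩
    have h := smul_mem_titsCone hw (combination_mem_titsCone hP (mul_mem (inv_mem hw) hu) hx hy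
      zero_le_one zero_le_one)
    simpa [mul_smul] using h

/-- An element of the reflection group moves points of the cone over `P` by a nonnegative
combination of the vectors `b_s`. -/
theorem exists_smul_eq_add_sum [Fintype S] (hP : P.IsVinberg) {w : SLpm n}
    (hw : w ∈ P.reflectionGroup) {x : Vec n} (hx : x ∈ P.cone) :
    ∃ c : S → ℝ, (∀ s, 0 ≤ c s) ∧ w • x = x + ∑ s, c s • P.b s := by
  classical
  induction hN : P.len w using Nat.strong_induction_on generalizing w with
  | _ N ih =>
  subst hN
  by_cases hw1 : w = 1
  · exact ⟨0, by simp, by simp [hw1]⟩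
  obtain ⟨s, hs⟩ := exists_len_refl_mul hw hw1
  have hsw := mul_mem (refl_mem s) hw
  obtain ⟨c, hc, h⟩ := ih _ (by omega) hsw rfl
  have hneg : P.α s ((P.refl s * w) • x) ≤ 0 :=
    α_smul_nonpos hP hsw (by rw [refl_mul_refl_mul]; omega) hx
  -- Undoing the first letter of a shortest word adds a multiple of `b_s` whose coefficient is
  -- nonnegative by `α_smul_nonpos`.
  refine ⟨c + Pi.single s (-P.α s ((P.refl s * w) • x)), fun r => ?_, ?_⟩
  · rw [Pi.add_apply]
    refine add_nonneg (hc r) ?_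
    by_cases hr : r = s
    · subst hr; simpa using hneg
    · simp [Pi.single_eq_of_ne hr]
  · have h1 : w • x = P.refl s • (P.refl s * w) • x := by
      rw [smul_smul, refl_mul_refl_mul]
    rw [h1, refl_smul]
    simp only [Pi.add_apply, add_smul, Finset.sum_add_distrib]
    rw [Finset.sum_eq_single_of_mem s (Finset.mem_univ _) (f := fun r =>
      (Pi.single s (-P.α s ((P.refl s * w) • x)) : S → ℝ) r • P.b r)]
    · rw [Pi.single_eq_same, ← add_assoc, ← h, neg_smul, sub_eq_add_neg]
    · intro r _ hr
      simp [Pi.single_eq_of_ne hr]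

end MirrorPolytope

/-! ### Cones and subsets of the projective sphere -/

section Sphere

variable {n : ℕ}

theorem rayOfNeZero_mem_sph {U : Set (Vec n)} (hU : ∀ c : ℝ, 0 < c → ∀ v ∈ U, c • v ∈ U)
    {v : Vec n} (hv : v ≠ 0) : rayOfNeZero ℝ v hv ∈ sph U ↔ v ∈ U := by
  constructor
  · rintro ⟨w, hw, hwU, h⟩
    obtain ⟨c, hc, rfl⟩ := ((ray_eq_iff hw hv).1 h).exists_pos_left hw hv
    exact hU c hc w hwU
  · exact fun h => ⟨v, hv, h, rfl⟩

theorem toSphere_preimage_sph {U : Set (Vec n)} (hU : ∀ c : ℝ, 0 < c → ∀ v ∈ U, c • v ∈ U) :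
    toSphere n ⁻¹' sph U = {v | v.1 ∈ U} := by
  ext v
  exact rayOfNeZero_mem_sph hU v.2

theorem rayOfNeZero_mem_halfSpace {α : Module.Dual ℝ (Vec n)} {v : Vec n} (hv : v ≠ 0) :
    rayOfNeZero ℝ v hv ∈ halfSpace α ↔ α v ≤ 0 := by
  rw [halfSpace, rayOfNeZero_mem_sph]
  · rfl
  · intro c hc v hv
    have hv' : α v ≤ 0 := hv
    change α (c • v) ≤ 0
    rw [map_smul, smul_eq_mul]
    exact mul_nonpos_of_nonneg_of_nonpos hc.le hv'

theorem continuous_toSphere : Continuous (toSphere n) := continuous_coinduced_rng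

theorem isOpen_sph {U : Set (Vec n)} (hU : ∀ c : ℝ, 0 < c → ∀ v ∈ U, c • v ∈ U)
    (h : ∀ v ∈ U, v ≠ 0 → U ∈ nhds v) : IsOpen (sph U) := by
  rw [isOpen_coinduced, toSphere_preimage_sph hU, isOpen_iff_mem_nhds]
  intro v hv
  exact continuous_subtype_val.continuousAt.preimage_mem_nhds (h v.1 hv v.2)

theorem isClosed_sph {U : Set (Vec n)} (hU : ∀ c : ℝ, 0 < c → ∀ v ∈ U, c • v ∈ U)
    (h : IsClosed U) : IsClosed (sph U) := by
  rw [isClosed_coinduced, toSphere_preimage_sph hU]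
  exact h.preimage continuous_subtype_val

theorem isCompact_sph {U : Set (Vec n)} (hU : ∀ c : ℝ, 0 < c → ∀ v ∈ U, c • v ∈ U)
    (h : IsClosed U) : IsCompact (sph U) := by
  have hc : IsCompact (U ∩ Metric.sphere 0 1) := (isCompact_sphere 0 1).inter_left h
  have hne : ∀ v ∈ U ∩ Metric.sphere 0 1, v ≠ 0 := by
    rintro v ⟨-, hv⟩ rfl
    simp at hv
  have hc' : IsCompact {v : {v : Vec n // v ≠ 0} | v.1 ∈ U ∩ Metric.sphere 0 1} := by
    rw [Subtype.isCompact_iff]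
    convert hc using 1
    ext v
    simp only [Set.mem_image, Subtype.exists]
    constructor
    · rintro ⟨w, hw, h, rfl⟩
      exact h
    · exact fun h => ⟨v, hne v h, h, rfl⟩
  convert hc'.image continuous_toSphere using 1
  ext x
  constructor
  · rintro ⟨v, hv, hvU, rfl⟩
    have hpos : 0 < ‖v‖⁻¹ := inv_pos.2 (norm_pos_iff.2 hv)
    have hne' : ‖v‖⁻¹ • v ≠ 0 := smul_ne_zero hpos.ne' hv
    refine ⟨⟨‖v‖⁻¹ • v, hne'⟩, ⟨hU _ hpos v hvU, ?_⟩, ray_pos_smul hv hpos hne'⟩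
    simp [norm_smul, inv_mul_cancel₀ (norm_pos_iff.2 hv).ne']
  · rintro ⟨v, hv, rfl⟩
    exact ⟨v.1, v.2, hv.1, rfl⟩

/-- The sets `{v | ‖v‖ ≤ ℓ v}` and their subsets project to sets whose closure contains no
antipodal points. -/
theorem neg_notMem_closure_sph {U : Set (Vec n)} {ℓ : Module.Dual ℝ (Vec n)}
    (hU : ∀ v ∈ U, ‖v‖ ≤ ℓ v) {x : ProjSphere n} (hx : x ∈ closure (sph U)) :
    -x ∉ closure (sph U) := by
  set E : Set (Vec n) := {v | ‖v‖ ≤ ℓ v}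
  have hE : ∀ c : ℝ, 0 < c → ∀ v ∈ E, c • v ∈ E := by
    intro c hc v hv
    change ‖c • v‖ ≤ ℓ (c • v)
    rw [norm_smul, map_smul, smul_eq_mul, Real.norm_of_nonneg hc.le]
    exact mul_le_mul_of_nonneg_left hv hc.le
  have hclosed : IsClosed E :=
    isClosed_le continuous_norm (LinearMap.continuous_of_finiteDimensional ℓ)
  have hsub : closure (sph U) ⊆ sph E := by
    refine closure_minimal ?_ (isClosed_sph hE hclosed)
    rintro _ ⟨v, hv, hvU, rfl⟩
    exact ⟨v, hv, hU v hvU, rfl⟩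
  intro hx'
  obtain ⟨v, hv, hvE, rfl⟩ := hsub hx
  have h2 := hsub hx'
  rw [neg_rayOfNeZero, rayOfNeZero_mem_sph hE] at h2
  have h3 : ‖-v‖ ≤ ℓ (-v) := h2
  have h4 : ‖v‖ ≤ ℓ v := hvE
  rw [norm_neg, map_neg] at h3
  have := norm_pos_iff.2 hv
  linarith

theorem continuous_smul_vec (w : SLpm n) : Continuous fun v : Vec n => w • v :=
  LinearMap.continuous_of_finiteDimensional
    ((w : Vec n ≃ₗ[ℝ] Vec n) : Vec n →ₗ[ℝ] Vec n)

theorem continuous_SLpm_smul (v : Vec n) : Continuous fun w : SLpm n => w • v := by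
  have h : (fun w : SLpm n => w • v) = fun w : SLpm n => Matrix.mulVec
      (LinearMap.toMatrix' ((w : Vec n ≃ₗ[ℝ] Vec n) : Vec n →ₗ[ℝ] Vec n)) v := by
    funext w
    rw [LinearMap.toMatrix'_mulVec]
    rfl
  rw [h]
  exact Continuous.matrix_mulVec continuous_induced_dom continuous_const

end Sphere

/-! ### Vinberg's theorem for the orbit of the polytope -/

namespace MirrorPolytope

variable {n : ℕ} {S : Type} [Finite S] {P : MirrorPolytope n S}

theorem smul_mem_cone (c : ℝ) (hc : 0 < c) (v : Vec n) (hv : v ∈ P.cone) : c • v ∈ P.cone := by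
  intro s
  rw [map_smul, smul_eq_mul]
  exact mul_nonpos_of_nonneg_of_nonpos hc.le (hv s)

theorem carrier_eq : P.carrier = sph P.cone := by
  rw [P.isPolytope.2.2.1]
  ext x
  induction x using Module.Ray.ind with
  | h v hv =>
  rw [rayOfNeZero_mem_sph smul_mem_cone, Set.mem_iInter]
  exact forall_congr' fun s => rayOfNeZero_mem_halfSpace hv

theorem isClosed_cone : IsClosed P.cone := by
  have : P.cone = ⋂ s, {v | P.α s v ≤ 0} := by ext; simp [cone]
  rw [this]
  exact isClosed_iInter fun s =>
    isClosed_le (LinearMap.continuous_of_finiteDimensional _) continuous_const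

theorem isCompact_carrier : IsCompact P.carrier := by
  rw [carrier_eq]
  exact isCompact_sph smul_mem_cone isClosed_cone

theorem orbit_eq : P.orbit = sph P.titsCone := by
  ext x
  simp only [orbit, Set.mem_iUnion, carrier_eq, exists_prop]
  constructor
  · rintro ⟨w, hw, y, ⟨v, hv, hvc, rfl⟩, rfl⟩
    exact ⟨w • v, (smul_ne_zero_iff_ne _).2 hv, ⟨w, hw, v, hvc, rfl⟩, rfl⟩
  · rintro ⟨_, hv', ⟨w, hw, v, hvc, rfl⟩, rfl⟩
    have hv := (smul_ne_zero_iff_ne _).1 hv'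
    exact ⟨w, hw, _, ⟨v, hv, hvc, rfl⟩, rfl⟩

theorem smul_orbit {w : SLpm n} (hw : w ∈ P.reflectionGroup) : w • P.orbit = P.orbit := by
  have key : ∀ w ∈ P.reflectionGroup, w • P.orbit ⊆ P.orbit := by
    intro w hw
    rw [orbit_eq]
    rintro _ ⟨_, ⟨v, hv, hvc, rfl⟩, rfl⟩
    exact ⟨w • v, (smul_ne_zero_iff_ne _).2 hv, smul_mem_titsCone hw hvc, rfl⟩
  refine (key w hw).antisymm ?_
  rw [Set.subset_smul_set_iff]
  exact key _ (inv_mem hw)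

theorem carrier_subset_orbit : P.carrier ⊆ P.orbit := by
  intro x hx
  simp only [orbit, Set.mem_iUnion]
  exact ⟨1, one_mem _, by rwa [one_smul]⟩

/-- At an interior point, equality `α s v = 0` is impossible: moving slightly along `b s` would
raise the form above zero. -/
theorem exists_forall_α_neg : ∃ v : Vec n, ∀ s, P.α s v < 0 := by
  obtain ⟨x, hx⟩ := P.isPolytope.2.1
  induction x using Module.Ray.ind with
  | h v hv =>
  refine ⟨v, fun s => ?_⟩
  have hnhds : ∀ᶠ w : {v : Vec n // v ≠ 0} in nhds ⟨v, hv⟩, P.α s w ≤ 0 := by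
    have := continuous_toSphere.continuousAt.preimage_mem_nhds
      (x := (⟨v, hv⟩ : {v : Vec n // v ≠ 0})) (mem_interior_iff_mem_nhds.1 hx)
    filter_upwards [this] with w hw
    rw [carrier_eq, toSphere_preimage_sph smul_mem_cone] at hw
    exact hw s
  rw [nhds_subtype_eq_comap, Filter.eventually_comap] at hnhds
  have hcont : Filter.Tendsto (fun ε : ℝ => v + ε • P.b s) (nhds 0) (nhds v) := by
    have : Continuous fun ε : ℝ => v + ε • P.b s := by fun_prop
    simpa using this.tendsto 0
  have h1 := hcont.eventually hnhds
  have h2 := hcont.eventually (isOpen_ne.mem_nhds hv)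
  have h3 : ∃ᶠ ε : ℝ in nhds 0, 0 < ε := by
    have h : ∃ᶠ ε : ℝ in nhdsWithin 0 (Set.Ioi 0), 0 < ε :=
      Filter.Eventually.frequently self_mem_nhdsWithin
    exact h.filter_mono nhdsWithin_le_nhds
  obtain ⟨ε, hε, h1, h2⟩ := (h3.and_eventually (h1.and h2)).exists
  have := h1 ⟨_, h2⟩ rfl
  change P.α s (v + ε • P.b s) ≤ 0 at this
  rw [map_add, map_smul, smul_eq_mul, P.apply_self] at this
  linarith

/-- A nontrivial element carries an interior point of the cone out of the interior, so orbit maps of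
that point separate each group element from the others. -/
theorem discreteTopology_reflectionGroup (hP : P.IsVinberg) :
    DiscreteTopology P.reflectionGroup := by
  obtain ⟨x, hx⟩ := P.exists_forall_α_neg
  rw [discreteTopology_iff_isOpen_singleton]
  intro w
  have hopen : IsOpen {v : Vec n | ∀ s, P.α s v < 0} := by
    simp only [Set.ofPred_forall]
    exact isOpen_iInter_of_finite fun s =>
      isOpen_lt (LinearMap.continuous_of_finiteDimensional _) continuous_const
  have hcont : Continuous fun u : P.reflectionGroup => (w : SLpm n)⁻¹ • (u : SLpm n) • x :=
    (continuous_smul_vec _).comp ((continuous_SLpm_smul x).comp continuous_subtype_val)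
  convert hopen.preimage hcont
  ext u
  constructor
  · rintro rfl
    simpa using hx
  · intro hu
    by_contra hne
    obtain ⟨s, hs⟩ := exists_α_smul_nonneg hP (mul_mem (inv_mem w.2) u.2)
      (fun h => hne (Subtype.ext (inv_mul_eq_one.1 h).symm)) fun s => (hx s).le
    rw [mul_smul] at hs
    exact hs.not_gt (hu s)

/-- If a point of the cone over `P` has a finite stabilizer, then the images of the cone cover a
neighbourhood of it. -/
theorem titsCone_mem_nhds {ℓ : Module.Dual ℝ (Vec n)} (hℓ : ∀ s, 0 < ℓ (P.b s)) {x : Vec n}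
    (hx : x ∈ P.cone)
    (hfin : (Subgroup.closure (P.refl '' {s | P.α s x = 0}) : Set (SLpm n)).Finite) :
    P.titsCone ∈ nhds x := by
  set F := Subgroup.closure (P.refl '' {s | P.α s x = 0}) with hF
  have hFΓ : F ≤ P.reflectionGroup := Subgroup.closure_mono (Set.image_subset_range _ _)
  have hfix : ∀ w ∈ F, w • x = x := by
    have : F ≤ MulAction.stabilizer (SLpm n) x := by
      rw [hF, Subgroup.closure_le]
      rintro _ ⟨s, hs, rfl⟩
      have hs : P.α s x = 0 := hs
      change P.refl s • x = x
      rw [refl_smul, hs, zero_smul, sub_zero]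
    exact fun w hw => this hw
  -- Walls not through `x` stay strictly on the negative side for all translates of nearby points by
  -- the finite stabilizer.
  have hev : ∀ᶠ y in nhds x, ∀ w ∈ (F : Set (SLpm n)), ∀ s, P.α s x ≠ 0 → P.α s (w • y) < 0 := by
    rw [Filter.eventually_all_finite hfin]
    intro w hw
    rw [Filter.eventually_all]
    intro s
    by_cases hs : P.α s x = 0
    · simp [hs]
    · have hc : Continuous fun y : Vec n => P.α s (w • y) :=
        (LinearMap.continuous_of_finiteDimensional _).comp (continuous_smul_vec w)
      have : P.α s (w • x) < 0 := by
        rw [hfix w hw]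
        exact lt_of_le_of_ne (hx s) hs
      filter_upwards [hc.continuousAt.eventually_lt continuousAt_const this] with y hy _
      exact hy
  filter_upwards [hev] with y hy
  -- The translate minimizing `ℓ` satisfies the remaining inequalities: if `α_s` were positive
  -- there, `σ_s` would lower `ℓ` by `α_s` times `ℓ(b_s) > 0`.
  obtain ⟨w, hw, hmin⟩ := Set.exists_min_image (F : Set (SLpm n)) (fun w => ℓ (w • y)) hfin
    ⟨1, one_mem _⟩
  refine ⟨w⁻¹, inv_mem (hFΓ hw), w • y, fun s => ?_, inv_smul_smul _ _⟩
  by_cases hs : P.α s x = 0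
  · have := hmin (P.refl s * w) (mul_mem (Subgroup.subset_closure ⟨s, hs, rfl⟩) hw)
    rw [mul_smul, refl_smul, map_sub, map_smul ℓ (P.α s (w • y)), smul_eq_mul] at this
    have := hℓ s
    by_contra! hpos
    nlinarith [mul_pos hpos this]
  · exact (hy w hw s hs).le

variable [Fintype S]

/-- Points of the Tits cone are nonnegative combinations of the poles, and on each pole the norm is
a bounded multiple of `ℓ`. The sum of the ratios is a crude common bound. -/
theorem norm_le_of_mem_titsCone (hP : P.IsVinberg) {ℓ : Module.Dual ℝ (Vec n)}
    (hℓ : ∀ s, 0 < ℓ (P.b s))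
    (hcone : ∀ x ∈ P.cone, ∃ c : S → ℝ, (∀ s, 0 ≤ c s) ∧ x = ∑ s, c s • P.b s) :
    ∃ M : ℝ, ∀ v ∈ P.titsCone, ‖v‖ ≤ (M • ℓ) v := by
  refine ⟨∑ s, ‖P.b s‖ / ℓ (P.b s), ?_⟩
  rintro _ ⟨w, hw, x, hx, rfl⟩
  obtain ⟨c, hc, h⟩ := exists_smul_eq_add_sum hP hw hx
  obtain ⟨d, hd, rfl⟩ := hcone x hx
  rw [h, ← Finset.sum_add_distrib]
  simp only [← add_smul]
  set e : S → ℝ := fun s => d s + c s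
  have he : ∀ s, 0 ≤ e s := fun s => add_nonneg (hd s) (hc s)
  rw [LinearMap.smul_apply, map_sum, smul_eq_mul, Finset.mul_sum]
  refine (norm_sum_le _ _).trans (Finset.sum_le_sum fun s _ => ?_)
  rw [norm_smul, Real.norm_of_nonneg (he s), map_smul, smul_eq_mul]
  have h1 : ‖P.b s‖ / ℓ (P.b s) ≤ ∑ s, ‖P.b s‖ / ℓ (P.b s) :=
    Finset.single_le_sum (f := fun s => ‖P.b s‖ / ℓ (P.b s))
      (fun s _ => div_nonneg (norm_nonneg _) (hℓ s).le) (Finset.mem_univ s)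
  rw [div_le_iff₀ (hℓ s)] at h1
  calc e s * ‖P.b s‖ ≤ e s * ((∑ s, ‖P.b s‖ / ℓ (P.b s)) * ℓ (P.b s)) :=
        mul_le_mul_of_nonneg_left h1 (he s)
    _ = _ := by ring

/-- A version of Vinberg's theorem: if all faces of `P` have finite stabilizers and the vectors
`b_s` lie in an open half-space and span a cone containing that of `P`, then the reflection group
divides the orbit of `P`. -/
theorem divides_orbit (hP : P.IsVinberg) {ℓ : Module.Dual ℝ (Vec n)} (hℓ : ∀ s, 0 < ℓ (P.b s))
    (hcone : ∀ x ∈ P.cone, ∃ c : S → ℝ, (∀ s, 0 ≤ c s) ∧ x = ∑ s, c s • P.b s)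
    (hfin : ∀ x ∈ P.cone, x ≠ 0 →
      (Subgroup.closure (P.refl '' {s | P.α s x = 0}) : Set (SLpm n)).Finite) :
    Divides P.reflectionGroup P.orbit := by
  have hopen : IsOpen P.orbit := by
    rw [orbit_eq]
    refine isOpen_sph (fun c hc v hv => (titsConvexCone hP).smul_mem hc hv) ?_
    rintro _ ⟨w, hw, x, hx, rfl⟩ hne
    have hx0 : x ≠ 0 := (smul_ne_zero_iff_ne _).1 hne
    have h1 := titsCone_mem_nhds hℓ hx (hfin x hx hx0)
    have h2 : P.titsCone ∈ nhds (w⁻¹ • w • x) := by rwa [inv_smul_smul]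
    filter_upwards [(continuous_smul_vec w⁻¹).continuousAt.preimage_mem_nhds h2] with y hy
    simpa using smul_mem_titsCone hw hy
  obtain ⟨M, hM⟩ := norm_le_of_mem_titsCone hP hℓ hcone
  refine ⟨⟨?_, hopen, ⟨titsConvexCone hP, orbit_eq⟩, fun x hx => ?_⟩, fun w hw => smul_orbit hw,
    discreteTopology_reflectionGroup hP, P.carrier, isCompact_carrier, carrier_subset_orbit, rfl⟩
  · exact (P.isPolytope.2.1.mono interior_subset).mono carrier_subset_orbit
  · rw [orbit_eq] at hx ⊢
    exact neg_notMem_closure_sph hM hx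

end MirrorPolytope

end ProjGeom

/-- The group generated by two commuting sets, each generating a finite group, is finite. -/
theorem Subgroup.finite_closure_union_of_commute {G : Type*} [Group G] {X Y : Set G}
    (hX : (Subgroup.closure X : Set G).Finite) (hY : (Subgroup.closure Y : Set G).Finite)
    (hXY : ∀ x ∈ X, ∀ y ∈ Y, Commute x y) : (Subgroup.closure (X ∪ Y) : Set G).Finite := by
  have hcomm : ∀ (x : Subgroup.closure X) (y : Subgroup.closure Y),
      Commute ((Subgroup.closure X).subtype x) ((Subgroup.closure Y).subtype y) := by
    have h1 : Subgroup.closure Y ≤ Subgroup.centralizer X := by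
      rw [Subgroup.closure_le]
      exact fun y hy => Subgroup.mem_centralizer_iff.2 fun x hx => hXY x hx y hy
    have h2 : Subgroup.closure X ≤ Subgroup.centralizer (Subgroup.closure Y : Set G) := by
      rw [Subgroup.closure_le]
      exact fun x hx => Subgroup.mem_centralizer_iff.2 fun y hy =>
        (Subgroup.mem_centralizer_iff.1 (h1 hy) x hx).symm
    exact fun x y => (Subgroup.mem_centralizer_iff.1 (h2 x.2) y y.2).symm
  have := hX.to_subtype
  have := hY.to_subtype
  have h := MonoidHom.noncommCoprod_range _ _ hcomm
  rw [Subgroup.range_subtype, Subgroup.range_subtype, ← Subgroup.closure_union] at h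
  rw [← h, MonoidHom.coe_range]
  exact Set.finite_range _

/-- The trace of an endomorphism that is the identity on an invariant subspace. -/
theorem LinearMap.trace_eq_finrank_add_of_eq_id_on {K V ι : Type*} [Field K] [AddCommGroup V]
    [Module K V] [FiniteDimensional K V] [Fintype ι] [DecidableEq ι] (g : V →ₗ[K] V)
    (H : Submodule K V) (hH : H ≤ H.comap g) (e : Module.Basis ι K (V ⧸ H))
    (hid : ∀ v ∈ H, g v = v) :
    LinearMap.trace K V g =
      Module.finrank K H + (LinearMap.toMatrix e e (H.mapQ H g hH)).trace := by
  let bH := Module.finBasis K H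
  rw [LinearMap.trace_eq_matrix_trace K (Module.Basis.sumQuot bH e), Matrix.trace,
    Fintype.sum_sum_type]
  congr 1
  · simp [LinearMap.toMatrix_apply, Matrix.diag, hid]
  · rw [Matrix.trace]
    refine Finset.sum_congr rfl fun j _ => ?_
    rw [Matrix.diag, Matrix.diag, LinearMap.toMatrix_apply, LinearMap.toMatrix_apply,
      Module.Basis.sumQuot_repr_inr, ← Module.Basis.sumQuot_inr bH e j, H.mapQ_apply]
    rfl

/-! ### Dihedral angles read off from traces -/

namespace ProjGeom

theorem IsRotation.trace_eq {n : ℕ} {g : SLpm n} {θ : ℝ} (h : IsRotation g θ) :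
    LinearMap.trace ℝ (Vec n) ((g : Vec n ≃ₗ[ℝ] Vec n) : Vec n →ₗ[ℝ] Vec n) =
      n - 1 + 2 * Real.cos θ := by
  obtain ⟨-, -, H, hH, e, hid, hmat⟩ := h
  rw [LinearMap.trace_eq_finrank_add_of_eq_id_on _ H hH e hid, hmat]
  have h1 := H.finrank_quotient_add_finrank
  rw [Module.finrank_eq_card_basis e, Module.finrank_fin_fun, Fintype.card_fin] at h1
  have h2 : (Module.finrank ℝ H : ℝ) = n - 1 := by
    have : (2 : ℝ) + Module.finrank ℝ H = n + 1 := by exact_mod_cast h1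
    linarith
  rw [h2, Matrix.trace_fin_two]
  simp
  ring

namespace MirrorPolytope

variable {n : ℕ} {S : Type} [Finite S] {P : MirrorPolytope n S}

theorem trace_refl_mul_refl (s t : S) :
    LinearMap.trace ℝ (Vec n)
        (((P.refl s * P.refl t : SLpm n) : Vec n ≃ₗ[ℝ] Vec n) : Vec n →ₗ[ℝ] Vec n) =
      n - 3 + P.α s (P.b t) * P.α t (P.b s) := by
  have h : (((P.refl s * P.refl t : SLpm n) : Vec n ≃ₗ[ℝ] Vec n) : Vec n →ₗ[ℝ] Vec n) =
      LinearMap.id - (P.α t).smulRight (P.b t) - (P.α s).smulRight (P.b s) +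
        P.α s (P.b t) • (P.α t).smulRight (P.b s) := by
    apply LinearMap.ext
    intro v
    change (P.refl s * P.refl t) • v = _
    rw [mul_smul, refl_smul, α_refl_smul, refl_smul]
    simp only [LinearMap.add_apply, LinearMap.sub_apply, LinearMap.smul_apply,
      LinearMap.smulRight_apply, LinearMap.id_apply]
    module
  rw [h]
  simp only [map_add, map_sub, map_smul, LinearMap.trace_smulRight, LinearMap.trace_id,
    P.apply_self, Module.finrank_fin_fun, smul_eq_mul]
  push_cast
  ring

/-- Equating the trace of a rotation of angle `2θ` with that of the product of reflections gives
`α_s(b_t) α_t(b_s) = 4 cos² θ`. Injectivity of the cosine identifies `θ` with `π/m`, and a product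
of at least `4` excludes a positive angle. -/
theorem IsVinberg.isCoxeter (hP : P.IsVinberg) : P.IsCoxeter := by
  rintro s t ⟨hst, -⟩ θ (⟨h0, hπ, hrot⟩ | ⟨h, -⟩)
  swap
  · exact Or.inl h
  right
  have htr := hrot.trace_eq
  rw [trace_refl_mul_refl, Real.cos_two_mul] at htr
  have hcos : 0 ≤ Real.cos θ := Real.cos_nonneg_of_mem_Icc ⟨by linarith [Real.pi_pos], hπ⟩
  obtain ⟨m, ⟨hm, h⟩ | ⟨-, h⟩⟩ := hP s t hst
  · refine ⟨m, hm, ?_⟩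
    have hm' : (2 : ℝ) ≤ m := by exact_mod_cast hm
    have h1 : Real.cos θ = Real.cos (Real.pi / m) :=
      (sq_eq_sq₀ hcos (cos_pi_div_nonneg hm)).1 (by linarith)
    refine Real.injOn_cos ⟨h0.le, by linarith [Real.pi_pos]⟩ ⟨by positivity, ?_⟩ h1
    exact div_le_self Real.pi_pos.le (by linarith)
  · have h1 : Real.cos θ < 1 := by
      rw [← Real.cos_zero]
      exact Real.cos_lt_cos_of_nonneg_of_le_pi le_rfl (by linarith [Real.pi_pos]) h0
    nlinarith

end MirrorPolytope

/-! ### The blocks of the matrix `C t` -/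

/-- The upper left block of `C t`. -/
def blockA (t : ℝ) : Matrix (Fin 5) (Fin 5) ℝ := (C t).toBlocks₁₁

/-- The lower right block of `C t`. -/
def blockB (t : ℝ) : Matrix (Fin 5) (Fin 5) ℝ := (C t).toBlocks₂₂

theorem blockA_eq (t : ℝ) : blockA t =
    !![2, -gbar 0 t, -gbar 1 t, -gbar 2 t, -gbar 3 t;
       -g 0 t, 2, -gbar 0 t, -gbar 1 t, -gbar 2 t;
       -g 1 t, -g 0 t, 2, -gbar 0 t, -gbar 1 t;
       -g 2 t, -g 1 t, -g 0 t, 2, -gbar 0 t;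
       -g 3 t, -g 2 t, -g 1 t, -g 0 t, 2] := Matrix.toBlocks_fromBlocks₁₁ _ _ _ _

theorem blockB_eq (t : ℝ) : blockB t =
    !![2, -(1 / t), -(1 / t), -(1 / t), -(1 / t);
       -t, 2, -(1 / t), -(1 / t), -(1 / t);
       -t, -t, 2, -(1 / t), -(1 / t);
       -t, -t, -t, 2, -(1 / t);
       -t, -t, -t, -t, 2] := Matrix.toBlocks_fromBlocks₂₂ _ _ _ _

theorem C_inl_inl (t : ℝ) (i j : Fin 5) : C t (Sum.inl i) (Sum.inl j) = blockA t i j := rfl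

theorem C_inr_inr (t : ℝ) (i j : Fin 5) : C t (Sum.inr i) (Sum.inr j) = blockB t i j := rfl

theorem C_inl_inr (t : ℝ) (i j : Fin 5) :
    C t (Sum.inl i) (Sum.inr j) = if i = j then -h t else 0 :=
  Matrix.diagonal_apply (fun _ => -h t) i j

theorem C_inr_inl (t : ℝ) (i j : Fin 5) :
    C t (Sum.inr i) (Sum.inl j) = if i = j then -2 else 0 :=
  Matrix.diagonal_apply (fun _ => -2) i j

variable {t : ℝ}

theorem f_pos (ht : 0 < t) : 0 < f t := by
  unfold f
  positivity

theorem g_pos (ht : 0 < t) (q : ℕ) : 0 < g q t := by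
  unfold g
  positivity

theorem gbar_pos (ht : 0 < t) (q : ℕ) : 0 < gbar q t :=
  div_pos (mul_pos four_pos (f_pos ht)) (g_pos ht q)

theorem gbar_mul_g (ht : 0 < t) (q : ℕ) : gbar q t * g q t = 4 * f t :=
  div_mul_cancel₀ _ (g_pos ht q).ne'

/-- Because `g q * g (3 - q) = 4 t² f`. This form has no quotient by `g`, so the product of the
blocks can be checked over the common denominator of the `g q`. -/
theorem gbar_eq (ht : 0 < t) {q : ℕ} (hq : q ≤ 3) : gbar q t = g (3 - q) t / t ^ 2 := by
  have hg := (g_pos ht q).ne'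
  rw [gbar, div_eq_div_iff hg (by positivity)]
  unfold f g
  interval_cases q <;> norm_num <;> field_simp <;> ring

theorem two_lt_h (ht : 0 < t) : 2 < h t := by
  have : 0 < 1 / t + t * (t + 2) ^ 4 / ((t ^ 2 + t + 1) * (t ^ 2 + 7 * t + 1)) := by positivity
  unfold h
  linarith

theorem blockA_diag (i : Fin 5) : blockA t i i = 2 := by
  rw [blockA_eq]
  fin_cases i <;> rfl

theorem blockB_diag (i : Fin 5) : blockB t i i = 2 := by
  rw [blockB_eq]
  fin_cases i <;> rfl

theorem blockA_neg (ht : 0 < t) {i j : Fin 5} (hij : i ≠ j) : blockA t i j < 0 := by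
  have h1 := g_pos ht
  have h2 := gbar_pos ht
  rw [blockA_eq]
  fin_cases i <;> fin_cases j <;> first | exact absurd rfl hij | simp [h1, h2]

theorem blockB_neg (ht : 0 < t) {i j : Fin 5} (hij : i ≠ j) : blockB t i j < 0 := by
  rw [blockB_eq]
  fin_cases i <;> fin_cases j <;> first | exact absurd rfl hij | simp [ht]

theorem blockA_mul_swap (ht : 0 < t) {i j : Fin 5} (hij : i ≠ j) :
    blockA t i j * blockA t j i = 4 * f t := by
  have h1 := gbar_mul_g ht
  have h2 : ∀ q, g q t * gbar q t = 4 * f t := fun q => by rw [mul_comm, h1]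
  rw [blockA_eq]
  fin_cases i <;> fin_cases j <;> first | exact absurd rfl hij | simp [h1, h2]

theorem blockB_mul_swap (ht : 0 < t) {i j : Fin 5} (hij : i ≠ j) :
    blockB t i j * blockB t j i = 1 := by
  have := ht.ne'
  rw [blockB_eq]
  fin_cases i <;> fin_cases j <;> first | exact absurd rfl hij | simp [this]

theorem blockA_mul_blockB (ht : 0 < t) : blockA t * blockB t = (2 * h t) • 1 := by
  have ht' := ht.ne'
  set D := (t ^ 2 + t + 1) * (t ^ 2 + 7 * t + 1) with hD
  have hD0 : D ≠ 0 := by positivity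
  have g0 : g 0 t = 2 * (2 * t + 1) ^ 3 / D := by simp [g, hD]
  have g1 : g 1 t = 2 * t * (t + 2) * (2 * t + 1) ^ 2 / D := by simp [g, hD]
  have g2 : g 2 t = 2 * t ^ 2 * (t + 2) ^ 2 * (2 * t + 1) / D := by simp [g, hD]
  have g3 : g 3 t = 2 * t ^ 3 * (t + 2) ^ 3 / D := by simp [g, hD]
  have hh : h t = 2 + 1 / t + t * (t + 2) ^ 4 / D := rfl
  rw [blockA_eq, blockB_eq, gbar_eq ht (by norm_num), gbar_eq ht (by norm_num),
    gbar_eq ht (by norm_num), gbar_eq ht (by norm_num)]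
  norm_num only [g0, g1, g2, g3, hh]
  ext i j
  fin_cases i <;> fin_cases j <;>
    simp [Matrix.mul_apply, Fin.sum_univ_five] <;> field_simp <;> rw [hD] <;> ring

theorem blockB_mul_blockA (ht : 0 < t) : blockB t * blockA t = (2 * h t) • 1 := by
  have hh : 2 * h t ≠ 0 := by linarith [two_lt_h ht]
  have h1 : ((2 * h t)⁻¹ • blockA t) * blockB t = 1 := by
    rw [Matrix.smul_mul, blockA_mul_blockB ht, smul_smul, inv_mul_cancel₀ hh, one_smul]
  have h2 := mul_eq_one_comm.1 h1
  rw [Matrix.mul_smul] at h2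
  rw [← h2, smul_smul, mul_inv_cancel₀ hh, one_smul]

theorem exists_pos_pow_five_eq (ht : 0 < t) : ∃ u : ℝ, 0 < u ∧ u ^ 5 = t :=
  ⟨t ^ (1 / 5 : ℝ), by positivity, by
    rw [← Real.rpow_natCast, ← Real.rpow_mul ht.le]
    norm_num⟩

/-- With `t = u⁵`, the geometric vector `u^(8 - 2i)` is a left eigenvector: dividing column `j` by
its `j`-th entry always leaves the exponents `±1, ±3`. The eigenvalue `2 - (u³ + u + u⁻¹ + u⁻³)` is
negative. -/
theorem exists_pos_vecMul_blockB_neg (ht : 0 < t) :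
    ∃ l : Fin 5 → ℝ, (∀ i, 0 < l i) ∧ ∀ j, ∑ i, l i * blockB t i j < 0 := by
  obtain ⟨u, hu, rfl⟩ := exists_pos_pow_five_eq ht
  refine ⟨![u ^ 8, u ^ 6, u ^ 4, u ^ 2, 1], fun i => ?_, fun j => ?_⟩
  · fin_cases i <;> simp <;> positivity
  · have hsum : ∑ i, ![u ^ 8, u ^ 6, u ^ 4, u ^ 2, 1] i * blockB (u ^ 5) i j =
        -(![u ^ 5, u ^ 3, u, 1 / u, 1 / u ^ 3] j * ((u ^ 3 - 1) ^ 2 + u ^ 4 + u ^ 2)) := by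
      rw [blockB_eq]
      fin_cases j <;> simp [Fin.sum_univ_five] <;> field_simp <;> ring
    have hpos : 0 < ![u ^ 5, u ^ 3, u, 1 / u, 1 / u ^ 3] j := by
      fin_cases j <;> simp <;> positivity
    rw [hsum, neg_lt_zero]
    positivity

/-- The matrix is symmetric about its antidiagonal, so reversing the left vector gives a right one.
-/
theorem exists_pos_mulVec_blockB_neg (ht : 0 < t) :
    ∃ y : Fin 5 → ℝ, (∀ i, 0 < y i) ∧ ∀ i, (blockB t).mulVec y i < 0 := by
  obtain ⟨l, hl, hlB⟩ := exists_pos_vecMul_blockB_neg ht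
  refine ⟨fun i => l i.rev, fun i => hl _, fun i => ?_⟩
  have hsymm : ∀ i j, blockB t i j = blockB t j.rev i.rev := by
    intro i j
    rw [blockB_eq]
    fin_cases i <;> fin_cases j <;> rfl
  convert hlB i.rev using 1
  rw [Matrix.mulVec, dotProduct, ← Equiv.sum_comp Fin.revPerm]
  refine Finset.sum_congr rfl fun j _ => ?_
  rw [Fin.revPerm_apply, Fin.rev_rev, hsymm, Fin.rev_rev, mul_comm]

/-! ### The faces of the polytope -/

section Faces

variable {M : Matrix (Fin 5) (Fin 5) ℝ} {y : Fin 5 → ℝ}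

/-- Row `i` is a sum of nonpositive terms. Geometrically, the facets `i'` and `i` are disjoint. -/
theorem eq_zero_of_mulVec_apply_eq_zero (hneg : ∀ i j, i ≠ j → M i j < 0) (hy : ∀ i, 0 ≤ y i)
    {i : Fin 5} (hi : y i = 0) (hMi : M.mulVec y i = 0) : y = 0 := by
  have hnonpos : ∀ j ∈ Finset.univ, M i j * y j ≤ 0 := by
    intro j _
    by_cases hij : i = j
    · rw [← hij, hi, mul_zero]
    · exact mul_nonpos_of_nonpos_of_nonneg (hneg i j hij).le (hy j)
  rw [Matrix.mulVec, dotProduct, Finset.sum_eq_zero_iff_of_nonpos hnonpos] at hMi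
  funext j
  by_cases hij : i = j
  · rw [← hij, hi]; rfl
  · exact (mul_eq_zero.1 (hMi j (Finset.mem_univ _))).resolve_left (hneg i j hij).ne

/-- Only two coordinates can remain, and on them `M` is a block with diagonal `2` and off-diagonal
product `κ < 4`. Eliminating one coordinate gives `(4 - κ) y_l ≤ 0`. Geometrically, no three facets
of one family meet. -/
theorem eq_zero_of_three_zeros {κ : ℝ} (hκ : κ < 4) (hdiag : ∀ i, M i i = 2)
    (hneg : ∀ i j, i ≠ j → M i j < 0) (hmul : ∀ i j, i ≠ j → M i j * M j i = κ)
    (hy : ∀ i, 0 ≤ y i) (hMy : ∀ i, M.mulVec y i ≤ 0) {i j k : Fin 5} (hij : i ≠ j)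
    (hik : i ≠ k) (hjk : j ≠ k) (hi : y i = 0) (hj : y j = 0) (hk : y k = 0) : y = 0 := by
  have key : ∀ l m, l ≠ m → (∀ r, r ≠ l → r ≠ m → y r = 0) → y l = 0 := by
    intro l m hlm hr
    have hsum : ∀ a, M.mulVec y a = M a l * y l + M a m * y m := fun a =>
      Finset.sum_eq_add (s := Finset.univ) (f := fun r => M a r * y r) l m hlm
        (fun r _ h => by rw [hr r h.1 h.2, mul_zero]) (by simp) (by simp)
    have h1 := hMy l
    have h2 := hMy m
    rw [hsum, hdiag] at h1 h2
    have h3 := mul_nonneg_of_nonpos_of_nonpos (hneg l m hlm).le h2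
    have h4 := hmul l m hlm
    have h5 : M l m * (M m l * y l + 2 * y m) = κ * y l + 2 * (M l m * y m) := by
      rw [← h4]; ring
    have := hy l
    nlinarith
  obtain ⟨l, m, hlm, h⟩ : ∃ l m, l ≠ m ∧ ∀ r, r ≠ l → r ≠ m → r = i ∨ r = j ∨ r = k := by
    clear hi hj hk
    revert i j k
    decide
  have hz : ∀ r, r ≠ l → r ≠ m → y r = 0 := fun r h1 h2 => by
    rcases h r h1 h2 with rfl | rfl | rfl <;> assumption
  funext r
  by_cases h1 : r = l
  · rw [h1]; exact key l m hlm hz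
  by_cases h2 : r = m
  · rw [h2]; exact key m l hlm.symm fun r h1 h2 => hz r h2 h1
  exact hz r h1 h2

end Faces

theorem finite_closure_image_of_no_three {G ι : Type*} [Group G] {σ : ι → G}
    (hσ : ∀ i, σ i * σ i = 1) {m : ℕ} (hm : m ≠ 0) (hpow : ∀ i j, i ≠ j → (σ i * σ j) ^ m = 1)
    {I : Set ι} (hI : ∀ i ∈ I, ∀ j ∈ I, ∀ k ∈ I, i ≠ j → i ≠ k → j ≠ k → False) :
    (Subgroup.closure (σ '' I) : Set G).Finite := by
  obtain rfl | ⟨i, hi⟩ := I.eq_empty_or_nonempty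
  · simp
  by_cases h : ∃ j ∈ I, i ≠ j
  · obtain ⟨j, hj, hij⟩ := h
    refine (finite_closure_pair (hσ i) (hσ j) hm (hpow i j hij)).subset
      (Subgroup.closure_mono ?_)
    rintro _ ⟨k, hk, rfl⟩
    by_cases h1 : i = k
    · subst h1; simp
    by_cases h2 : j = k
    · subst h2; simp
    exact (hI i hi j hj k hk hij h1 h2).elim
  · push Not at h
    refine (finite_closure_pair (hσ i) (hσ i) one_ne_zero (by rw [pow_one, hσ])).subset
      (Subgroup.closure_mono ?_)
    rintro _ ⟨k, hk, rfl⟩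
    rw [← h k hk]; simp

namespace MirrorPolytope

/-! ### Polytopes with Cartan matrix `C t` -/

section Cartan

variable {P : MirrorPolytope 4 (Fin 5 ⊕ Fin 5)} {d : Fin 5 ⊕ Fin 5 → ℝ} {t : ℝ}

/-- The lower left block is `-2` times the identity, so up to scaling the forms `α (inr i)` and the
poles `b (inl i)` are dual bases. -/
theorem eq_sum_b_inl (hd : ∀ s, 0 < d s)
    (hC : ∀ s r, P.α s (P.b r) = d s * C t s r * (d r)⁻¹) (x : Vec 4) :
    x = ∑ j, (-P.α (Sum.inr j) x / d (Sum.inr j) / 2 * d (Sum.inl j)) • P.b (Sum.inl j) := by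
  have hα : ∀ (c : Fin 5 → ℝ) i, P.α (Sum.inr i) (∑ j, c j • P.b (Sum.inl j)) =
      -(2 * c i * d (Sum.inr i) / d (Sum.inl i)) := by
    intro c i
    rw [map_sum, Finset.sum_eq_single i]
    · rw [map_smul, hC, C_inr_inl, if_pos rfl, smul_eq_mul]
      ring
    · intro j _ hj
      rw [map_smul, hC, C_inr_inl, if_neg hj.symm]
      simp
    · simp
  have hli : LinearIndependent ℝ fun j => P.b (Sum.inl j) := by
    rw [Fintype.linearIndependent_iff]
    intro c hc i
    have h := hα c i
    rw [hc, map_zero] at h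
    have h1 := (hd (Sum.inl i)).ne'
    have h2 := (hd (Sum.inr i)).ne'
    rw [zero_eq_neg, div_eq_zero_iff, mul_eq_zero, mul_eq_zero] at h
    simpa [h1, h2] using h
  have hspan := hli.span_eq_top_of_card_eq_finrank' (by simp)
  obtain ⟨c, hc⟩ := (Submodule.mem_span_range_iff_exists_fun ℝ).1
    (hspan ▸ Submodule.mem_top (x := x))
  conv_lhs => rw [← hc]
  refine Finset.sum_congr rfl fun j _ => ?_
  congr 1
  rw [← hc, hα]
  have h1 := (hd (Sum.inl j)).ne'
  have h2 := (hd (Sum.inr j)).ne'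
  field_simp

/-- The normalized coordinates `y` (unprimed forms) and `y'` (primed forms) are nonnegative on the
cone. Applying the primed forms to `eq_sum_b_inl` gives `A y = -2 y'`, and `A * B = 2h • 1` inverts
this to `B y' = -h y` below. -/
theorem blockA_mulVec (hd : ∀ s, 0 < d s)
    (hC : ∀ s r, P.α s (P.b r) = d s * C t s r * (d r)⁻¹) (x : Vec 4) :
    (blockA t).mulVec (fun j => -P.α (Sum.inr j) x / d (Sum.inr j)) =
      (-2 : ℝ) • fun i => -P.α (Sum.inl i) x / d (Sum.inl i) := by
  funext i
  have h1 := (hd (Sum.inl i)).ne'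
  have h := congrArg (P.α (Sum.inl i)) (eq_sum_b_inl hd hC x)
  rw [map_sum] at h
  rw [Pi.smul_apply, h, Matrix.mulVec, dotProduct, smul_eq_mul, neg_div, neg_mul_neg,
    Finset.sum_div, Finset.mul_sum]
  refine Finset.sum_congr rfl fun j _ => ?_
  have h2 := (hd (Sum.inl j)).ne'
  have h3 := (hd (Sum.inr j)).ne'
  rw [map_smul, hC, C_inl_inl, smul_eq_mul]
  field_simp

theorem blockB_mulVec (ht : 0 < t) (hd : ∀ s, 0 < d s)
    (hC : ∀ s r, P.α s (P.b r) = d s * C t s r * (d r)⁻¹) (x : Vec 4) :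
    (blockB t).mulVec (fun i => -P.α (Sum.inl i) x / d (Sum.inl i)) =
      -h t • fun j => -P.α (Sum.inr j) x / d (Sum.inr j) := by
  have h1 := congrArg (blockB t).mulVec (blockA_mulVec hd hC x)
  rw [Matrix.mulVec_mulVec, blockB_mul_blockA ht, Matrix.mulVec_smul, Matrix.smul_mulVec,
    Matrix.one_mulVec] at h1
  funext i
  have h2 := congrFun h1 i
  simp only [Pi.smul_apply, smul_eq_mul] at h2 ⊢
  linarith

theorem pairOrder_inl_inl (ht : 0 < t) {p : ℕ} (hp : 2 ≤ p)
    (hf : Real.cos (Real.pi / p) ^ 2 = f t) (hd : ∀ s, 0 < d s)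
    (hC : ∀ s r, P.α s (P.b r) = d s * C t s r * (d r)⁻¹) {i j : Fin 5} (hij : i ≠ j) :
    P.PairOrder (Sum.inl i) (Sum.inl j) p := by
  refine Or.inl ⟨hp, ?_⟩
  have h1 := (hd (Sum.inl i)).ne'
  have h2 := (hd (Sum.inl j)).ne'
  rw [hf, ← blockA_mul_swap ht hij, hC, hC, C_inl_inl, C_inl_inl]
  field_simp

theorem pairOrder_inr_inr (ht : 0 < t) (hd : ∀ s, 0 < d s)
    (hC : ∀ s r, P.α s (P.b r) = d s * C t s r * (d r)⁻¹) {i j : Fin 5} (hij : i ≠ j) :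
    P.PairOrder (Sum.inr i) (Sum.inr j) 3 := by
  refine Or.inl ⟨by norm_num, ?_⟩
  have h1 := (hd (Sum.inr i)).ne'
  have h2 := (hd (Sum.inr j)).ne'
  have h3 : 4 * Real.cos (Real.pi / (3 : ℕ)) ^ 2 = 1 := by
    rw [Nat.cast_ofNat, Real.cos_pi_div_three]; norm_num
  rw [h3, ← blockB_mul_swap ht hij, hC, hC, C_inr_inr, C_inr_inr]
  field_simp

theorem pairOrder_inl_inr (hC : ∀ s r, P.α s (P.b r) = d s * C t s r * (d r)⁻¹) {i j : Fin 5}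
    (hij : i ≠ j) : P.PairOrder (Sum.inl i) (Sum.inr j) 2 := by
  refine Or.inl ⟨le_rfl, ?_⟩
  rw [hC, C_inl_inr, if_neg hij]
  simp

theorem pairOrder_inl_inr_self (ht : 0 < t) (hd : ∀ s, 0 < d s)
    (hC : ∀ s r, P.α s (P.b r) = d s * C t s r * (d r)⁻¹) (i : Fin 5) :
    P.PairOrder (Sum.inl i) (Sum.inr i) 0 := by
  refine Or.inr ⟨rfl, ?_⟩
  have h1 := (hd (Sum.inl i)).ne'
  have h2 := (hd (Sum.inr i)).ne'
  have h3 := two_lt_h ht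
  have h4 : P.α (Sum.inl i) (P.b (Sum.inr i)) * P.α (Sum.inr i) (P.b (Sum.inl i)) = 2 * h t := by
    rw [hC, hC, C_inl_inr, C_inr_inl, if_pos rfl, if_pos rfl]
    field_simp
  linarith

theorem PairOrder.symm {n : ℕ} {S : Type} [Finite S] {P : MirrorPolytope n S} {s r : S} {m : ℕ}
    (h : P.PairOrder s r m) : P.PairOrder r s m := by
  unfold PairOrder at *
  rwa [mul_comm]

theorem isVinberg_of_cartan (ht : 0 < t) {p : ℕ} (hp : 2 ≤ p)
    (hf : Real.cos (Real.pi / p) ^ 2 = f t) (hd : ∀ s, 0 < d s)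
    (hC : ∀ s r, P.α s (P.b r) = d s * C t s r * (d r)⁻¹) : P.IsVinberg := by
  have hmixed : ∀ i j, ∃ m, P.PairOrder (Sum.inl i) (Sum.inr j) m := by
    intro i j
    by_cases hij : i = j
    · subst hij
      exact ⟨0, pairOrder_inl_inr_self ht hd hC i⟩
    · exact ⟨2, pairOrder_inl_inr hC hij⟩
  rintro (i | i) (j | j) hij
  · exact ⟨p, pairOrder_inl_inl ht hp hf hd hC fun h => hij (congrArg _ h)⟩
  · exact hmixed i j
  · exact (hmixed j i).imp fun m h => h.symm
  · exact ⟨3, pairOrder_inr_inr ht hd hC fun h => hij (congrArg _ h)⟩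

theorem finite_stabilizer_of_cartan (ht : 0 < t) {p : ℕ} (hp : 2 ≤ p)
    (hf : Real.cos (Real.pi / p) ^ 2 = f t) (hf1 : f t < 1) (hd : ∀ s, 0 < d s)
    (hC : ∀ s r, P.α s (P.b r) = d s * C t s r * (d r)⁻¹) {x : Vec 4} (hx : x ∈ P.cone)
    (hx0 : x ≠ 0) : (Subgroup.closure (P.refl '' {s | P.α s x = 0}) : Set (SLpm 4)).Finite := by
  set y : Fin 5 → ℝ := fun j => -P.α (Sum.inr j) x / d (Sum.inr j) with hy
  set y' : Fin 5 → ℝ := fun i => -P.α (Sum.inl i) x / d (Sum.inl i) with hy'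
  have hAy : (blockA t).mulVec y = (-2 : ℝ) • y' := blockA_mulVec hd hC x
  have hBy' : (blockB t).mulVec y' = -h t • y := blockB_mulVec ht hd hC x
  have hy0 : ∀ j, 0 ≤ y j := fun j => div_nonneg (neg_nonneg.2 (hx _)) (hd _).le
  have hy'0 : ∀ j, 0 ≤ y' j := fun j => div_nonneg (neg_nonneg.2 (hx _)) (hd _).le
  have hyz : ∀ {j}, P.α (Sum.inr j) x = 0 → y j = 0 := fun {j} hj => by simp [hy, hj]
  have hy'z : ∀ {j}, P.α (Sum.inl j) x = 0 → y' j = 0 := fun {j} hj => by simp [hy', hj]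
  have hyne : y ≠ 0 := by
    intro h0
    apply hx0
    rw [eq_sum_b_inl hd hC x]
    refine Finset.sum_eq_zero fun j _ => ?_
    have : -P.α (Sum.inr j) x / d (Sum.inr j) = 0 := congrFun h0 j
    rw [this]
    simp
  have hh : h t ≠ 0 := by linarith [two_lt_h ht]
  have hy'ne : y' ≠ 0 := by
    intro h0
    rw [h0, Matrix.mulVec_zero] at hBy'
    exact hyne ((smul_eq_zero.1 hBy'.symm).resolve_left (neg_ne_zero.2 hh))
  have himage : P.refl '' {s | P.α s x = 0} =
      (fun i => P.refl (Sum.inl i)) '' {i | P.α (Sum.inl i) x = 0} ∪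
        (fun j => P.refl (Sum.inr j)) '' {j | P.α (Sum.inr j) x = 0} := by
    ext w
    simp only [Set.mem_image, Set.mem_union, Set.mem_ofPred_eq, Sum.exists]
  rw [himage]
  refine Subgroup.finite_closure_union_of_commute
    (finite_closure_image_of_no_three (fun i => P.refl_mul_self _) (m := p) (by omega)
      (fun i j hij => (pairOrder_inl_inl ht hp hf hd hC hij).refl_mul_refl_pow (by simpa)) ?_)
    (finite_closure_image_of_no_three (fun i => P.refl_mul_self _) (m := 3) (by norm_num)
      (fun i j hij => (pairOrder_inr_inr ht hd hC hij).refl_mul_refl_pow (by simpa)) ?_) ?_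
  · intro i hi j hj k hk hij hik hjk
    refine hy'ne (eq_zero_of_three_zeros (κ := 1) (by norm_num) blockB_diag
      (fun _ _ => blockB_neg ht) (fun _ _ => blockB_mul_swap ht) hy'0 (fun r => ?_) hij hik hjk
      (hy'z hi) (hy'z hj) (hy'z hk))
    rw [hBy', Pi.smul_apply, smul_eq_mul]
    nlinarith [hy0 r, two_lt_h ht]
  · intro i hi j hj k hk hij hik hjk
    refine hyne (eq_zero_of_three_zeros (κ := 4 * f t) (by linarith) blockA_diag
      (fun _ _ => blockA_neg ht) (fun _ _ => blockA_mul_swap ht) hy0 (fun r => ?_) hij hik hjk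
      (hyz hi) (hyz hj) (hyz hk))
    rw [hAy, Pi.smul_apply, smul_eq_mul]
    nlinarith [hy'0 r]
  · rintro _ ⟨i, hi, rfl⟩ _ ⟨j, hj, rfl⟩
    -- Facets `i'` and `i` do not meet away from the origin, so only the mixed pairs with commuting
    -- reflections occur in a stabilizer.
    have hij : i ≠ j := by
      rintro rfl
      refine hyne (eq_zero_of_mulVec_apply_eq_zero (M := blockA t) (fun _ _ => blockA_neg ht) hy0
        (hyz hj) ?_)
      rw [hAy, Pi.smul_apply, hy'z hi, smul_zero]
    have := altProd_comm (P.refl_mul_self (Sum.inl i)) (P.refl_mul_self (Sum.inr j))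
      ((pairOrder_inl_inr hC hij).refl_mul_refl_pow (by simp))
    simpa [altProd, Commute, SemiconjBy] using this

theorem divides_of_cartan (ht : 0 < t) {p : ℕ} (hp : 2 ≤ p)
    (hf : Real.cos (Real.pi / p) ^ 2 = f t) (hf1 : f t < 1) (hd : ∀ s, 0 < d s)
    (hC : ∀ s r, P.α s (P.b r) = d s * C t s r * (d r)⁻¹) :
    Divides P.reflectionGroup P.orbit := by
  obtain ⟨l, hl, hlB⟩ := exists_pos_vecMul_blockB_neg ht
  -- On the primed poles only one entry `-2` contributes, giving a positive value. On the unprimed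
  -- poles the value is minus an entry of `l B`, up to positive scaling.
  let ℓ : Module.Dual ℝ (Vec 4) := ∑ i, (-(l i / d (Sum.inr i))) • P.α (Sum.inr i)
  have hℓ : ∀ s, ℓ (P.b s) = -(∑ i, l i * C t (Sum.inr i) s) * (d s)⁻¹ := by
    intro s
    simp only [ℓ, LinearMap.sum_apply, LinearMap.smul_apply, hC, smul_eq_mul]
    rw [← Finset.sum_neg_distrib, Finset.sum_mul]
    refine Finset.sum_congr rfl fun i _ => ?_
    have := (hd (Sum.inr i)).ne'
    field_simp
  refine divides_orbit (isVinberg_of_cartan ht hp hf hd hC) (ℓ := ℓ) ?_ ?_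
    fun x hx hx0 => finite_stabilizer_of_cartan ht hp hf hf1 hd hC hx hx0
  · intro s
    rw [hℓ]
    refine mul_pos ?_ (inv_pos.2 (hd s))
    rw [neg_pos]
    rcases s with j | j
    · rw [Finset.sum_eq_single j]
      · rw [C_inr_inl, if_pos rfl]
        linarith [hl j]
      · intro i _ hij
        rw [C_inr_inl, if_neg hij, mul_zero]
      · simp
    · exact hlB j
  · intro x hx
    refine ⟨Sum.elim (fun j => -P.α (Sum.inr j) x / d (Sum.inr j) / 2 * d (Sum.inl j)) 0, ?_, ?_⟩
    · rintro (j | j)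
      · exact mul_nonneg (div_nonneg (div_nonneg (neg_nonneg.2 (hx _)) (hd _).le) two_pos.le)
          (hd _).le
      · exact le_rfl
    · rw [Fintype.sum_sum_type]
      simpa using eq_sum_b_inl hd hC x

end Cartan

end MirrorPolytope

/-! ### Existence -/

section Existence

variable {t : ℝ}

/-- The linear forms of the standard polytope with Cartan matrix `C t`. -/
def stdForm (t : ℝ) : Fin 5 ⊕ Fin 5 → Module.Dual ℝ (Vec 4) :=
  Sum.elim (fun i => (1 / 2 : ℝ) • (LinearMap.proj i ∘ₗ (blockA t).mulVecLin))
    fun i => -LinearMap.proj i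

/-- The poles of the standard polytope with Cartan matrix `C t`. -/
def stdPole (t : ℝ) : Fin 5 ⊕ Fin 5 → Vec 4 :=
  Sum.elim (fun j => Pi.single j 2) fun j => -(blockB t).col j

theorem stdForm_inl (i : Fin 5) (v : Vec 4) :
    stdForm t (Sum.inl i) v = 1 / 2 * (blockA t).mulVec v i := rfl

theorem stdForm_inr (i : Fin 5) (v : Vec 4) : stdForm t (Sum.inr i) v = -v i := rfl

theorem stdForm_stdPole (ht : 0 < t) (s r : Fin 5 ⊕ Fin 5) :
    stdForm t s (stdPole t r) = C t s r := by
  rcases s with i | i <;> rcases r with j | j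
  · rw [stdForm_inl, C_inl_inl]
    simp [stdPole]
    ring
  · have h1 := congrFun (congrFun (blockA_mul_blockB ht) i) j
    rw [stdForm_inl, C_inl_inr]
    have h2 : (blockA t).mulVec (stdPole t (Sum.inr j)) i = -((blockA t * blockB t) i j) := by
      simp [stdPole, Matrix.mul_apply, Matrix.mulVec, dotProduct]
    rw [h2, h1, Matrix.smul_apply, Matrix.one_apply]
    split_ifs <;> simp
  · rw [stdForm_inr, C_inr_inl]
    simp only [stdPole, Sum.elim_inl, Pi.single_apply]
    split_ifs <;> simp
  · rw [stdForm_inr, C_inr_inr]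
    simp [stdPole]

theorem mem_iInter_halfSpace {n : ℕ} {S : Type} {α : S → Module.Dual ℝ (Vec n)} {v : Vec n}
    (hv : v ≠ 0) : rayOfNeZero ℝ v hv ∈ ⋂ s, halfSpace (α s) ↔ ∀ s, α s v ≤ 0 := by
  simp only [Set.mem_iInter, rayOfNeZero_mem_halfSpace]

/-- The intersection of half-spaces as the projection of a convex cone. -/
theorem iInter_halfSpace_eq_sph {n : ℕ} {S : Type} (α : S → Module.Dual ℝ (Vec n)) :
    ⋂ s, halfSpace (α s) = sph {v | ∀ s, α s v ≤ 0} := by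
  ext x
  induction x using Module.Ray.ind with
  | h v hv =>
  rw [mem_iInter_halfSpace hv, rayOfNeZero_mem_sph]
  · rfl
  · intro c hc v hv s
    rw [map_smul, smul_eq_mul]
    exact mul_nonpos_of_nonneg_of_nonpos hc.le (hv s)

theorem isConvex_iInter_halfSpace {n : ℕ} {S : Type} (α : S → Module.Dual ℝ (Vec n)) :
    IsConvex (⋂ s, halfSpace (α s)) :=
  ⟨{ carrier := {v | ∀ s, α s v ≤ 0}
     smul_mem' := fun c hc v hv s => by
       rw [map_smul, smul_eq_mul]
       exact mul_nonpos_of_nonneg_of_nonpos hc.le (hv s)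
     add_mem' := fun v hv w hw s => by
       rw [map_add]
       exact add_nonpos (hv s) (hw s) }, iInter_halfSpace_eq_sph α⟩

/-- In these coordinates the cone lies in the nonnegative orthant, where the coordinate sum
dominates the norm. The other witnesses have the form `e_i` or `-B y`, for which `A (-B y) = -2h y`.
-/
theorem isProjectivePolytope_std (ht : 0 < t) :
    IsProjectivePolytope (⋂ s, halfSpace (stdForm t s)) (stdForm t) := by
  have hh := two_lt_h ht
  have hAB : ∀ y : Vec 4, (blockA t).mulVec (-(blockB t).mulVec y) = -(2 * h t) • y := by
    intro y
    rw [Matrix.mulVec_neg, Matrix.mulVec_mulVec, blockA_mul_blockB ht, Matrix.smul_mulVec,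
      Matrix.one_mulVec, neg_smul]
  refine ⟨⟨isConvex_iInter_halfSpace _, fun x hx => ?_⟩, ?_, rfl, ?_⟩
  · rw [iInter_halfSpace_eq_sph] at hx ⊢
    refine neg_notMem_closure_sph (ℓ := ∑ i, LinearMap.proj i) (fun v hv => ?_) hx
    have hv0 : ∀ i, 0 ≤ v i := fun i => by
      have := hv (Sum.inr i)
      rw [stdForm_inr] at this
      linarith
    rw [LinearMap.sum_apply]
    simp only [LinearMap.proj_apply]
    rw [pi_norm_le_iff_of_nonneg (Finset.sum_nonneg fun i _ => hv0 i)]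
    intro i
    rw [Real.norm_of_nonneg (hv0 i)]
    exact Finset.single_le_sum (fun i _ => hv0 i) (Finset.mem_univ i)
  · obtain ⟨y, hy, hBy⟩ := exists_pos_mulVec_blockB_neg ht
    have hopen : IsOpen (sph {v : Vec 4 | ∀ s, stdForm t s v < 0}) := by
      refine isOpen_sph (fun c hc v hv s => ?_) fun v hv _ => ?_
      · rw [map_smul, smul_eq_mul]
        exact mul_neg_of_pos_of_neg hc (hv s)
      · refine IsOpen.mem_nhds ?_ hv
        simp only [Set.ofPred_forall]
        exact isOpen_iInter_of_finite fun s =>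
          isOpen_lt (LinearMap.continuous_of_finiteDimensional _) continuous_const
    have hsub : sph {v : Vec 4 | ∀ s, stdForm t s v < 0} ⊆ ⋂ s, halfSpace (stdForm t s) := by
      rintro _ ⟨v, hv, h, rfl⟩
      exact (mem_iInter_halfSpace hv).2 fun s => (h s).le
    have hneg : ∀ s, stdForm t s (-(blockB t).mulVec y) < 0 := by
      rintro (i | i)
      · rw [stdForm_inl, hAB, Pi.smul_apply, smul_eq_mul]
        nlinarith [hy i]
      · rw [stdForm_inr, Pi.neg_apply, neg_neg]
        exact hBy i
    have hne : -(blockB t).mulVec y ≠ 0 := fun h0 => by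
      have := hneg (Sum.inr 0)
      rw [h0, map_zero] at this
      exact lt_irrefl _ this
    exact ⟨_, interior_maximal hsub hopen ⟨_, hne, hneg, rfl⟩⟩
  · have key : ∀ (s : Fin 5 ⊕ Fin 5) (v : Vec 4), 0 < stdForm t s v →
        (∀ r, r ≠ s → stdForm t r v ≤ 0) →
        ¬ ((⋂ r ∈ {r | r ≠ s}, halfSpace (stdForm t r)) ⊆ halfSpace (stdForm t s)) := by
      intro s v hpos hneg hsub
      have hv : v ≠ 0 := by
        rintro rfl
        rw [map_zero] at hpos
        exact lt_irrefl _ hpos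
      have h1 : rayOfNeZero ℝ v hv ∈ ⋂ r ∈ {r | r ≠ s}, halfSpace (stdForm t r) := by
        simp only [Set.mem_iInter]
        exact fun r hr => (rayOfNeZero_mem_halfSpace hv).2 (hneg r hr)
      exact hpos.not_ge ((rayOfNeZero_mem_halfSpace hv).1 (hsub h1))
    rintro (i | i)
    · refine key _ (Pi.single i 1) ?_ ?_
      · rw [stdForm_inl]
        simp [blockA_diag]
      · rintro (j | j) hj
        · have hji : j ≠ i := fun h => hj (congrArg _ h)
          have := blockA_neg ht hji
          rw [stdForm_inl]
          simp
          linarith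
        · rw [stdForm_inr, neg_nonpos, Pi.single_apply]
          split_ifs <;> norm_num
    · refine key _ (-(blockB t).mulVec (Pi.single i 1)) ?_ ?_
      · rw [stdForm_inr]
        simp [blockB_diag]
      · rintro (j | j) hj
        · rw [stdForm_inl, hAB, Pi.smul_apply, Pi.single_apply, smul_eq_mul]
          split_ifs <;> nlinarith
        · have hji : j ≠ i := fun h => hj (congrArg _ h)
          have := blockB_neg ht hji
          rw [stdForm_inr]
          simp
          linarith

theorem C_diag (s : Fin 5 ⊕ Fin 5) : C t s s = 2 := by
  rcases s with i | i
  · exact blockA_diag i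
  · exact blockB_diag i

theorem C_sign (ht : 0 < t) (s r : Fin 5 ⊕ Fin 5) (hsr : s ≠ r) :
    (C t s r < 0 ∧ C t r s < 0) ∨ (C t s r = 0 ∧ C t r s = 0) := by
  have hh := two_lt_h ht
  rcases s with i | i <;> rcases r with j | j
  · have hij : i ≠ j := fun h => hsr (congrArg _ h)
    exact Or.inl ⟨blockA_neg ht hij, blockA_neg ht hij.symm⟩
  · rw [C_inl_inr, C_inr_inl]
    by_cases hij : i = j
    · left
      simp [hij]
      linarith
    · right
      simp [hij, Ne.symm hij]
  · rw [C_inl_inr, C_inr_inl]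
    by_cases hij : i = j
    · left
      simp [hij]
      linarith
    · right
      simp [hij, Ne.symm hij]
  · have hij : i ≠ j := fun h => hsr (congrArg _ h)
    exact Or.inl ⟨blockB_neg ht hij, blockB_neg ht hij.symm⟩

/-- The standard mirror polytope with Cartan matrix `C t`. -/
def stdPolytope (ht : 0 < t) : MirrorPolytope 4 (Fin 5 ⊕ Fin 5) where
  α := stdForm t
  b := stdPole t
  carrier := ⋂ s, halfSpace (stdForm t s)
  isPolytope := isProjectivePolytope_std ht
  apply_self s := by rw [stdForm_stdPole ht, C_diag]
  sign s r hsr := by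
    simp only [stdForm_stdPole ht]
    exact C_sign ht s r hsr

theorem t₃_pos : 0 < t₃ := by
  have h2 : √2 ^ 2 = 2 := Real.sq_sqrt (by norm_num)
  have h2' := Real.sqrt_nonneg 2
  have h : √(31 + 22 * √2) < (11 + 9 * √2) / 3 := by
    rw [Real.sqrt_lt' (by positivity)]
    nlinarith
  unfold t₃
  linarith

theorem t₃_le_one : t₃ ≤ 1 := by
  have h2 : √2 ^ 2 = 2 := Real.sq_sqrt (by norm_num)
  have h2' := Real.sqrt_nonneg 2
  have h : 3 + 3 * √2 ≤ √(31 + 22 * √2) := by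
    apply Real.le_sqrt_of_sq_le
    nlinarith
  unfold t₃
  linarith

/-- In terms of `x = t + 1/t`, `f` equals `(2x + 5)³ / ((x + 1)² (x + 7)²)`. The number `t₃` solves
`t + 1/t = 11 + 9√2`, a root of `x² - 22x - 41`, which divides the equation `f = 1/4` in `x`. -/
theorem f_t₃ : f t₃ = 1 / 4 := by
  have h0 := t₃_pos
  have h2 : √2 ^ 2 = 2 := Real.sq_sqrt (by norm_num)
  have h3 : √(31 + 22 * √2) ^ 2 = 31 + 22 * √2 := Real.sq_sqrt (by positivity)
  set x := 11 + 9 * √2 with hx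
  have hx0 : 0 < x := by positivity
  have hx2 : x ^ 2 = 22 * x + 41 := by
    rw [hx]
    linear_combination 81 * h2
  have hq : t₃ ^ 2 + 1 = x * t₃ := by
    unfold t₃
    rw [hx]
    linear_combination 9 / 4 * h3 - 81 / 4 * h2
  generalize t₃ = t at *
  have e1 : t ^ 2 + t + 1 = (x + 1) * t := by linear_combination hq
  have e2 : t ^ 2 + 7 * t + 1 = (x + 7) * t := by linear_combination hq
  have e3 : (t + 2) ^ 3 * (2 * t + 1) ^ 3 = ((2 * x + 5) * t) ^ 3 := by
    rw [← mul_pow]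
    congr 1
    linear_combination 2 * hq
  have e4 : 4 * (2 * x + 5) ^ 3 = (x + 1) ^ 2 * (x + 7) ^ 2 := by
    linear_combination -(x ^ 2 + 6 * x + 11) * hx2
  rw [f, e1, e2, mul_assoc t, e3, div_eq_div_iff (by positivity) (by norm_num)]
  linear_combination t ^ 4 * e4

theorem f_one : f 1 = 1 := by norm_num [f]

theorem exists_f_eq {c : ℝ} (h1 : 1 / 4 ≤ c) (h2 : c ≤ 1) : ∃ t ∈ Set.Icc t₃ 1, f t = c := by
  have hcont : ContinuousOn f (Set.Icc t₃ 1) := by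
    unfold f
    refine ContinuousOn.div (by fun_prop) (by fun_prop) fun t ht => ?_
    have := t₃_pos.trans_le ht.1
    positivity
  exact intermediate_value_Icc t₃_le_one hcont ⟨by rwa [f_t₃], by rwa [f_one]⟩

end Existence

end ProjGeom

theorem mainTheorem3 (p : ℕ) (hp : 3 ≤ p) :
    (∃ P : ProjGeom.MirrorPolytope 4 (Fin 5 ⊕ Fin 5),
      ProjGeom.IsPolytopeOfAngle (Real.pi / p) P) ∧
    ∀ P : ProjGeom.MirrorPolytope 4 (Fin 5 ⊕ Fin 5),
      ProjGeom.IsPolytopeOfAngle (Real.pi / p) P →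
        P.IsCoxeter ∧
        ProjGeom.IsProperlyConvexDomain P.orbit ∧
        interior P.orbit = P.orbit ∧
        ProjGeom.Divides P.reflectionGroup P.orbit := by
  have hp' : (3 : ℝ) ≤ p := by exact_mod_cast hp
  have hpos : 0 < Real.pi / p := by positivity
  have hle : Real.pi / p ≤ Real.pi / 3 := by gcongr
  have hcos : 1 / 2 ≤ Real.cos (Real.pi / p) := by
    rw [← Real.cos_pi_div_three]
    exact Real.cos_le_cos_of_nonneg_of_le_pi hpos.le (by linarith [Real.pi_pos]) hle
  have hcos1 : Real.cos (Real.pi / p) < 1 := by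
    rw [← Real.cos_zero]
    exact Real.cos_lt_cos_of_nonneg_of_le_pi le_rfl (by linarith [Real.pi_pos]) hpos
  constructor
  · obtain ⟨t, ht, hf⟩ := ProjGeom.exists_f_eq (c := Real.cos (Real.pi / p) ^ 2)
      (by nlinarith) (by nlinarith)
    refine ⟨ProjGeom.stdPolytope (ProjGeom.t₃_pos.trans_le ht.1), ⟨hpos.le, hle⟩, t, ht, hf.symm,
      1, by simp, fun s r => ?_⟩
    rw [Pi.one_apply, Pi.one_apply, one_mul, inv_one, mul_one]
    exact ProjGeom.stdForm_stdPole (ProjGeom.t₃_pos.trans_le ht.1) s r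
  · rintro P ⟨-, t, ht, hf, d, hd, hC⟩
    have ht0 := ProjGeom.t₃_pos.trans_le ht.1
    -- As `p` is finite, `cos (π/p) < 1` and hence `f t < 1`, which keeps three primed facets from
    -- meeting.
    have hdiv := P.divides_of_cartan ht0 (by omega) hf (by nlinarith) hd hC
    exact ⟨(P.isVinberg_of_cartan ht0 (by omega) hf hd hC).isCoxeter, hdiv.1,
      hdiv.1.2.1.interior_eq, hdiv⟩

end
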